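/- An MV-algebra is a structure $(A,\oplus,{}^*,0)$ such that $(A,\oplus,0)$ is a commutative monoid, $x^{**}=x$, $(x^*\oplus y)^*\oplus y=(y^*\oplus x)^*\oplus x$ and $0^*\oplus x=0^*$. Put $x\odot y=(x^*\oplus y^*)^*$, $x\le y$ iff $x\odot y^*=0$, and let $nx$ be the $n$-fold sum $x\oplus\dots\oplus x$. A DMV-algebra is an MV-algebra with unary operations $\delta_n$ ($n\ge 1$) such that $n\,\delta_n x=x$ and $\delta_n x\odot (n-1)\delta_n x=0$ for all $x$. An ideal is a subset containing $0$, closed under $\oplus$ and downward closed; $A/J$ is the quotient by the congruence $x\odot y^*\in J$ and $y\odot x^*\in J$. A maximal ideal is a proper ideal contained in no other proper ideal, and an algebra is semisimple if the intersection of its maximal ideals is $\{0\}$ (the intersection of the empty family is the whole algebra). Let $DMV_n$ be the free DMV-algebra on $n$ generators ($n\ge 0$). A DMV-algebra is finitely presented if it is isomorphic to $DMV_n/J$ for some $n$ and some finitely generated ideal $J$ of $DMV_n$. A rational simplex in $[0,1]^n$ is the convex hull of finitely many (at least one) affinely independent points of $[0,1]^n$ with rational coordinates, and a rational polyhedron in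 $[0,1]^n$ is a finite, possibly empty, union of rational simplexes. For $P\subseteq[0,1]^n$, let $DMV_n|_P$ be the DMV-algebra of the restrictions to $P$ of the continuous functions $f:[0,1]^n\to[0,1]$ for which there are finitely many affine functions with rational coefficients such that at every point $f$ agrees with one of them; its operations are pointwise, $f\oplus g=\min(f+g,1)$, $f^*=1-f$, $\delta_k f=f/k$. Then: (1) For every $n$, every principal ideal of $DMV_n$ is an intersection of maximal ideals of $DMV_n$. (2) For every $n$ and every principal ideal $J$ of $DMV_n$ there is a rational polyhedron $P\subseteq[0,1]^n$ such that $DMV_n/J\cong DMV_n|_P$ as DMV-algebras. (3) Every finitely presented DMV-algebra $D$ is semisimple, and $D\cong DMV_n|_P$ as DMV-algebras for some $n$ and some rational polyhedron $P\subseteq[0,1]^n$. -/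

import Mathlib

/-! ### MV-algebras and DMV-algebras -/

/-- An MV-algebra `(A, ⊕, *, 0)`. The sum `⊕` is written `+`, the involution `x*` is written `xᶜ`;
the iterated sum `x ⊕ ... ⊕ x` (`n` times) is `n • x`. -/
class MVAlgebra (A : Type*) extends AddCommMonoid A, Compl A where
  compl_invol : ∀ x : A, xᶜᶜ = x
  luk : ∀ x y : A, (xᶜ + y)ᶜ + y = (yᶜ + x)ᶜ + x
  compl_zero_add : ∀ x : A, (0 : A)ᶜ + x = (0 : A)ᶜ

namespace MVAlgebra

variable {A : Type*} [MVAlgebra A]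

/-- `x ⊙ y = (x* ⊕ y*)*`. -/
def odot (x y : A) : A := (xᶜ + yᶜ)ᶜ

theorem odot_compl_eq_zero_iff (x y : A) : odot x yᶜ = 0 ↔ xᶜ + y = (0 : A)ᶜ := by
  unfold odot
  rw [compl_invol]
  constructor
  · intro h
    rw [← h, compl_invol]
  · intro h
    rw [h, compl_invol]

theorem compl_add_self (x : A) : xᶜ + x = (0 : A)ᶜ := by
  have h := luk (0 : A)ᶜ x
  rw [compl_invol, zero_add] at h
  rw [h, add_comm, compl_zero_add]

theorem eq_add_of {x y : A} (h : xᶜ + y = (0 : A)ᶜ) : y = x + (yᶜ + x)ᶜ := by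
  have h2 := luk x y
  rw [h, compl_invol, zero_add] at h2
  rw [add_comm, ← h2]

/-- The natural order of an MV-algebra: `x ≤ y` if and only if `x ⊙ y* = 0`. -/
instance instPartialOrder : PartialOrder A where
  le x y := odot x yᶜ = 0
  le_refl x := (odot_compl_eq_zero_iff x x).2 (compl_add_self x)
  le_trans x y z hxy hyz := by
    rw [odot_compl_eq_zero_iff] at *
    rw [eq_add_of hyz, eq_add_of hxy, ← add_assoc, ← add_assoc, compl_add_self,
      compl_zero_add, compl_zero_add]
  le_antisymm x y hxy hyx := by
    rw [odot_compl_eq_zero_iff] at *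
    have h := eq_add_of hxy
    rw [hyx, compl_invol, add_zero] at h
    exact h.symm

theorem le_def (x y : A) : x ≤ y ↔ odot x yᶜ = 0 := Iff.rfl

theorem le_iff (x y : A) : x ≤ y ↔ xᶜ + y = (0 : A)ᶜ := odot_compl_eq_zero_iff x y

theorem zero_le' (x : A) : 0 ≤ x := by
  rw [le_iff, compl_zero_add]

theorem le_add (x y : A) : x ≤ x + y := by
  rw [le_iff, ← add_assoc, compl_add_self, compl_zero_add]

/-- Residuation: `x ⊙ y* ≤ z` if and only if `x ≤ y ⊕ z`. -/
theorem odot_compl_le_iff (x y z : A) : odot x yᶜ ≤ z ↔ x ≤ y + z := by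
  rw [le_iff, le_iff, odot, compl_invol, compl_invol, add_assoc]

theorem le_add_odot (x y : A) : x ≤ y + odot x yᶜ := (odot_compl_le_iff _ _ _).1 le_rfl

theorem compl_le {x y : A} (h : x ≤ y) : yᶜ ≤ xᶜ := by
  rw [le_iff] at *
  rw [compl_invol, add_comm, h]

theorem add_mono {x y z w : A} (h : x ≤ y) (h' : z ≤ w) : x + z ≤ y + w := by
  have h1 := eq_add_of ((le_iff _ _).1 h)
  have h2 := eq_add_of ((le_iff _ _).1 h')
  rw [h1, h2, add_add_add_comm]
  exact le_add _ _

theorem odot_mono {x y z w : A} (h : x ≤ y) (h' : z ≤ w) : odot x z ≤ odot y w :=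
  compl_le (add_mono (compl_le h) (compl_le h'))

theorem odot_compl_le (x y : A) : odot x yᶜ ≤ x := by
  rw [odot_compl_le_iff, add_comm]
  exact le_add _ _

theorem le_compl_of_odot {x y : A} (h : odot x y = 0) : x ≤ yᶜ := by
  rw [le_def, compl_invol, h]

theorem le_compl_comm {x y : A} (h : x ≤ yᶜ) : y ≤ xᶜ := by
  have := compl_le h
  rwa [compl_invol] at this

/-- Cancellation for sums with `x ⊙ y = 0`. -/
theorem odot_cancel {x y : A} (h : y ≤ xᶜ) : odot (x + y) xᶜ = y := by
  rw [le_iff] at h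
  have h2 := luk yᶜ x
  rw [compl_invol, add_comm xᶜ, h, compl_invol, zero_add, add_comm y] at h2
  rw [odot, compl_invol, h2, compl_invol]

theorem defined_assoc {a b c : A} (h : a ≤ bᶜ) (h' : a + b ≤ cᶜ) :
    b ≤ cᶜ ∧ a ≤ (b + c)ᶜ := by
  refine ⟨le_trans ?_ h', ?_⟩
  · rw [add_comm]
    exact le_add _ _
  · have h1 := odot_cancel h
    have h2 : odot (a + b) bᶜ ≤ odot cᶜ bᶜ := odot_mono h' le_rfl
    rw [add_comm a b, h1, odot, compl_invol, compl_invol, add_comm c b] at h2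
    exact h2

theorem defined_shuffle {a b c e : A} (h1 : a ≤ bᶜ) (h2 : c ≤ eᶜ) (h3 : a + b ≤ (c + e)ᶜ) :
    a + c ≤ (b + e)ᶜ := by
  obtain ⟨h4, h5⟩ := defined_assoc h1 h3
  obtain ⟨-, h7⟩ := defined_assoc h2 (le_compl_comm h4)
  rw [add_left_comm, add_comm] at h5
  have h8 : b + e + c ≤ aᶜ := le_compl_comm h5
  rw [add_comm e b] at h7
  have h9 := (defined_assoc (le_compl_comm h7) h8).2
  rw [add_comm a c]
  exact le_compl_comm h9

theorem exists_glb (p q : A) : ∃ r : A, r ≤ p ∧ r ≤ q ∧ ∀ s, s ≤ p → s ≤ q → s ≤ r := by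
  have hj : ∀ x y : A, x ≤ y + odot x yᶜ ∧ y ≤ y + odot x yᶜ ∧
      ∀ z, x ≤ z → y ≤ z → y + odot x yᶜ ≤ z := by
    refine fun x y => ⟨le_add_odot x y, le_add _ _, fun z hx hy => ?_⟩
    have h := eq_add_of ((le_iff _ _).1 hy)
    have h' : odot x yᶜ ≤ (zᶜ + y)ᶜ := by
      rw [odot_compl_le_iff, ← h]
      exact hx
    rw [h]
    exact add_mono le_rfl h'
  obtain ⟨h1, h2, h3⟩ := hj pᶜ qᶜ
  refine ⟨_, ?_, ?_, fun s hp hq => le_compl_comm (h3 _ (compl_le hp) (compl_le hq))⟩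
  · simpa only [compl_invol] using compl_le h1
  · simpa only [compl_invol] using compl_le h2

theorem nsmul_mono {x : A} {m k : ℕ} (h : m ≤ k) : m • x ≤ k • x := by
  obtain ⟨j, rfl⟩ := Nat.exists_eq_add_of_le h
  rw [add_nsmul]
  exact le_add _ _

theorem nsmul_defined {p r c : A} (hp : p = r + c) (hrc : r ≤ cᶜ) (n : ℕ)
    (hn : p ≤ ((n - 1) • p)ᶜ) : ∀ k ≤ n, k • r ≤ (k • c)ᶜ := by
  intro k
  induction k with
  | zero =>
    intro _
    rw [zero_nsmul, zero_nsmul]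
    exact zero_le' _
  | succ k ih =>
    intro hk
    rw [succ_nsmul, succ_nsmul]
    refine defined_shuffle (ih (by omega)) hrc ?_
    rw [← nsmul_add, ← hp]
    exact le_trans (nsmul_mono (by omega : k ≤ n - 1)) (le_compl_comm hn)

/-- Division by `n` in an MV-algebra is unique. -/
theorem divisor_unique {p q : A} {n : ℕ} (hn : 0 < n) (hp : odot p ((n - 1) • p) = 0)
    (hq : odot q ((n - 1) • q) = 0) (h : n • p = n • q) : p = q := by
  obtain ⟨r, hrp, hrq, hr⟩ := exists_glb p q
  have key : ∀ s, r ≤ s → s = r + odot s rᶜ ∧ r ≤ (odot s rᶜ)ᶜ := by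
    intro s hs
    refine ⟨?_, ?_⟩
    · have := eq_add_of ((le_iff _ _).1 hs)
      rwa [odot, compl_invol]
    · rw [odot, compl_invol, compl_invol, add_comm]
      exact le_add _ _
  obtain ⟨hpc, hrc⟩ := key p hrp
  obtain ⟨hqd, hrd⟩ := key q hrq
  generalize odot p rᶜ = c at hpc hrc
  generalize odot q rᶜ = d at hqd hrd
  have e1 := odot_cancel (le_compl_comm (nsmul_defined hpc hrc n (le_compl_of_odot hp) n le_rfl))
  have e2 := odot_cancel (le_compl_comm (nsmul_defined hqd hrd n (le_compl_of_odot hq) n le_rfl))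
  rw [← nsmul_add, ← hpc] at e1
  rw [← nsmul_add, ← hqd, ← h] at e2
  have hcd : n • c = n • d := e1.symm.trans e2
  have disj : ∀ e, e ≤ c → e ≤ d → e = 0 := by
    intro e hec hed
    have h1 : r + e ≤ r := hr _ (hpc ▸ add_mono le_rfl hec) (hqd ▸ add_mono le_rfl hed)
    have h2 : e ≤ rᶜ := le_trans hec (le_compl_comm hrc)
    have h3 := odot_cancel h2
    rw [← h3]
    exact (le_def _ _).1 h1
  have step : ∀ x y : A, (∀ e, e ≤ x → e ≤ y → e = 0) → ∀ k : ℕ, x ≤ k • y → x = 0 := by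
    intro x y hxy k
    induction k with
    | zero =>
      intro hx
      rw [zero_nsmul] at hx
      exact le_antisymm hx (zero_le' _)
    | succ k ih =>
      intro hx
      apply ih
      rw [succ_nsmul, ← odot_compl_le_iff] at hx
      exact hxy _ (odot_compl_le _ _) hx
  have one_le : ∀ x : A, x ≤ n • x := fun x => by
    simpa using nsmul_mono (x := x) (show 1 ≤ n from hn)
  have hc : c = 0 := step c d disj n (hcd ▸ one_le c)
  have hd : d = 0 := step d c (fun e h1 h2 => disj e h2 h1) n (hcd ▸ one_le d)
  rw [hpc, hqd, hc, hd]

end MVAlgebra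

/-- A DMV-algebra: an MV-algebra with operators `δ_n`, `n ≥ 1`, such that `n δ_n x = x` and
`δ_n x ⊙ (n - 1) δ_n x = 0`. -/
class DMVAlgebra (A : Type*) extends MVAlgebra A where
  delta : ℕ+ → A → A
  nsmul_delta : ∀ (n : ℕ+) (x : A), (n : ℕ) • delta n x = x
  delta_odot : ∀ (n : ℕ+) (x : A),
    MVAlgebra.odot (delta n x) (((n : ℕ) - 1) • delta n x) = 0

/-- Isomorphisms of DMV-algebras. -/
structure DMVIso (A B : Type*) [DMVAlgebra A] [DMVAlgebra B] extends A ≃+ B where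
  map_compl : ∀ x : A, toFun xᶜ = (toFun x)ᶜ
  map_delta : ∀ (n : ℕ+) (x : A),
    toFun (DMVAlgebra.delta n x) = DMVAlgebra.delta n (toFun x)

/-! ### Ideals -/

/-- Ideals of an MV-algebra: subsets containing `0`, closed under `⊕`, and downward closed.
The ideals of a DMV-algebra are those of its MV-algebra reduct. -/
structure MVIdeal (A : Type*) [MVAlgebra A] extends AddSubmonoid A where
  mem_of_le : ∀ {x y : A}, x ≤ y → y ∈ carrier → x ∈ carrier

namespace MVIdeal

section MV

variable {A : Type*} [MVAlgebra A]

instance : SetLike (MVIdeal A) A where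
  coe I := I.carrier
  coe_injective := by
    rintro ⟨I, _⟩ ⟨J, _⟩ h
    have : I = J := SetLike.coe_injective h
    subst this
    rfl

theorem zero_mem (I : MVIdeal A) : (0 : A) ∈ I := I.toAddSubmonoid.zero_mem'

theorem add_mem (I : MVIdeal A) {x y : A} (hx : x ∈ I) (hy : y ∈ I) : x + y ∈ I :=
  I.toAddSubmonoid.add_mem' hx hy

theorem lower (I : MVIdeal A) {x y : A} (h : x ≤ y) (hy : y ∈ I) : x ∈ I := I.mem_of_le h hy

/-- A maximal ideal: a proper ideal not strictly contained in any proper ideal. -/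
def IsMaximal (M : MVIdeal A) : Prop :=
  (M : Set A) ≠ Set.univ ∧
    ∀ I : MVIdeal A, (M : Set A) ⊆ I → (I : Set A) ≠ Set.univ → (I : Set A) = M

/-- The ideal generated by a set: the smallest ideal containing it. -/
def span (S : Set A) : MVIdeal A where
  carrier := {x | ∀ I : MVIdeal A, S ⊆ I → x ∈ I}
  zero_mem' := fun I _ => I.zero_mem
  add_mem' := fun hx hy I hI => I.add_mem (hx I hI) (hy I hI)
  mem_of_le := fun h hy I hI => I.lower h (hy I hI)

def IsPrincipal (J : MVIdeal A) : Prop := ∃ a : A, J = span {a}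

def IsFinitelyGenerated (J : MVIdeal A) : Prop := ∃ S : Set A, S.Finite ∧ J = span S

/-- `J` is the intersection of a family of maximal ideals (the intersection of the empty family
is the whole algebra). -/
def IsIntersectionOfMaximal (J : MVIdeal A) : Prop :=
  ∃ F : Set (MVIdeal A), (∀ M ∈ F, M.IsMaximal) ∧ (J : Set A) = ⋂ M ∈ F, (M : Set A)

/-- The congruence of an ideal `J`: `x ~ y` if and only if `x ⊙ y*` and `y ⊙ x*` are in `J`. -/
def setoid (J : MVIdeal A) : Setoid A where
  r x y := MVAlgebra.odot x yᶜ ∈ J ∧ MVAlgebra.odot y xᶜ ∈ J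
  iseqv := by
    have tr : ∀ x y z : A, MVAlgebra.odot x yᶜ ∈ J → MVAlgebra.odot y zᶜ ∈ J →
        MVAlgebra.odot x zᶜ ∈ J := by
      intro x y z h1 h2
      refine J.lower ?_ (J.add_mem h2 h1)
      rw [MVAlgebra.odot_compl_le_iff, ← add_assoc]
      exact le_trans (MVAlgebra.le_add_odot x y)
        (MVAlgebra.add_mono (MVAlgebra.le_add_odot y z) le_rfl)
    refine ⟨fun x => ?_, fun h => ⟨h.2, h.1⟩, fun h h' =>
      ⟨tr _ _ _ h.1 h'.1, tr _ _ _ h'.2 h.2⟩⟩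
    have : MVAlgebra.odot x xᶜ = 0 := (MVAlgebra.le_def x x).1 le_rfl
    rw [this]
    exact ⟨J.zero_mem, J.zero_mem⟩

/-- The quotient algebra `A / J`. -/
def Quot (J : MVIdeal A) : Type _ := Quotient J.setoid

variable (J : MVIdeal A)

/-- The class of `x` in `A / J`. -/
def toQuot (x : A) : J.Quot := Quotient.mk J.setoid x

theorem toQuot_surjective (q : J.Quot) : ∃ x, J.toQuot x = q := Quotient.exists_rep q

theorem setoid_add {x x' y y' : A} (h : J.setoid.r x x') (h' : J.setoid.r y y') :
    J.setoid.r (x + y) (x' + y') := by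
  have key : ∀ a b c d : A, MVAlgebra.odot (a + b) (c + d)ᶜ ≤
      MVAlgebra.odot a cᶜ + MVAlgebra.odot b dᶜ := by
    intro a b c d
    rw [MVAlgebra.odot_compl_le_iff, add_add_add_comm]
    exact MVAlgebra.add_mono (MVAlgebra.le_add_odot _ _) (MVAlgebra.le_add_odot _ _)
  exact ⟨J.lower (key _ _ _ _) (J.add_mem h.1 h'.1), J.lower (key _ _ _ _) (J.add_mem h.2 h'.2)⟩

theorem setoid_compl {x y : A} (h : J.setoid.r x y) : J.setoid.r xᶜ yᶜ := by
  have key : ∀ a b : A, MVAlgebra.odot aᶜ bᶜᶜ = MVAlgebra.odot b aᶜ := by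
    intro a b
    simp only [MVAlgebra.odot, MVAlgebra.compl_invol]
    rw [add_comm]
  change _ ∧ _
  rw [key, key]
  exact ⟨h.2, h.1⟩

instance instZero : Zero J.Quot := ⟨J.toQuot 0⟩

instance instAdd : Add J.Quot :=
  ⟨Quotient.map₂ (· + ·) (fun _ _ h _ _ h' => J.setoid_add h h')⟩

instance instQuotMV : MVAlgebra J.Quot where
  nsmul := nsmulRec
  compl := Quotient.map (·ᶜ) (fun _ _ h => J.setoid_compl h)
  add_assoc := by
    rintro ⟨x⟩ ⟨y⟩ ⟨z⟩
    exact congrArg J.toQuot (add_assoc x y z)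
  zero_add := by
    rintro ⟨x⟩
    exact congrArg J.toQuot (zero_add x)
  add_zero := by
    rintro ⟨x⟩
    exact congrArg J.toQuot (add_zero x)
  add_comm := by
    rintro ⟨x⟩ ⟨y⟩
    exact congrArg J.toQuot (add_comm x y)
  compl_invol := by
    rintro ⟨x⟩
    exact congrArg J.toQuot (MVAlgebra.compl_invol x)
  luk := by
    rintro ⟨x⟩ ⟨y⟩
    exact congrArg J.toQuot (MVAlgebra.luk x y)
  compl_zero_add := by
    rintro ⟨x⟩
    exact congrArg J.toQuot (MVAlgebra.compl_zero_add x)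

theorem toQuot_add (x y : A) : J.toQuot (x + y) = J.toQuot x + J.toQuot y := rfl

theorem toQuot_zero : J.toQuot 0 = 0 := rfl

theorem toQuot_odot (x y : A) :
    J.toQuot (MVAlgebra.odot x y) = MVAlgebra.odot (J.toQuot x) (J.toQuot y) := rfl

theorem toQuot_nsmul (n : ℕ) (x : A) : J.toQuot (n • x) = n • J.toQuot x := by
  induction n with
  | zero => rw [zero_nsmul, zero_nsmul, toQuot_zero]
  | succ n ih => rw [succ_nsmul, succ_nsmul, toQuot_add, ih]

end MV

section DMV

variable {A : Type*} [DMVAlgebra A] (J : MVIdeal A)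

theorem toQuot_delta_odot (n : ℕ+) (x : A) : MVAlgebra.odot (J.toQuot (DMVAlgebra.delta n x))
    (((n : ℕ) - 1) • J.toQuot (DMVAlgebra.delta n x)) = 0 := by
  rw [← toQuot_nsmul, ← toQuot_odot, DMVAlgebra.delta_odot, toQuot_zero]

theorem setoid_delta (n : ℕ+) {x y : A} (h : J.setoid.r x y) :
    J.setoid.r (DMVAlgebra.delta n x) (DMVAlgebra.delta n y) := by
  have hxy : J.toQuot x = J.toQuot y := Quotient.sound h
  refine Quotient.exact (s := J.setoid) (MVAlgebra.divisor_unique (A := J.Quot) n.pos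
    (J.toQuot_delta_odot n x) (J.toQuot_delta_odot n y) ?_)
  change (n : ℕ) • J.toQuot _ = (n : ℕ) • J.toQuot _
  rw [← toQuot_nsmul, ← toQuot_nsmul, DMVAlgebra.nsmul_delta, DMVAlgebra.nsmul_delta, hxy]

/-- The quotient of a DMV-algebra by an ideal, with the operations induced on classes. -/
instance instQuotDMV : DMVAlgebra J.Quot where
  delta n := Quotient.map (DMVAlgebra.delta n) (fun _ _ h => J.setoid_delta n h)
  nsmul_delta := by
    rintro n ⟨x⟩
    refine (J.toQuot_nsmul n (DMVAlgebra.delta n x)).symm.trans ?_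
    rw [DMVAlgebra.nsmul_delta]
    rfl
  delta_odot := by
    rintro n ⟨x⟩
    exact J.toQuot_delta_odot n x

end DMV

end MVIdeal

/-- An MV-algebra is semisimple if the intersection of its maximal ideals is `{0}`. -/
def IsSemisimpleMV (A : Type*) [MVAlgebra A] : Prop :=
  (⋂ M ∈ {M : MVIdeal A | M.IsMaximal}, (M : Set A)) = {0}

/-! ### Free DMV-algebras and finite presentations -/

/-- Terms in the language of DMV-algebras with variables `x_i`, `i : Fin n`. -/
inductive DMVTerm (n : ℕ) : Type
  | var (i : Fin n) : DMVTerm n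
  | zero : DMVTerm n
  | add (s t : DMVTerm n) : DMVTerm n
  | compl (t : DMVTerm n) : DMVTerm n
  | delta (k : ℕ+) (t : DMVTerm n) : DMVTerm n

namespace DMVTerm

variable {n : ℕ}

/-- The term `t ⊕ ... ⊕ t` (`k` times). -/
def nmul : ℕ → DMVTerm n → DMVTerm n
  | 0, _ => zero
  | k + 1, t => add (nmul k t) t

/-- The term `s ⊙ t`. -/
def odot (s t : DMVTerm n) : DMVTerm n := compl (add (compl s) (compl t))

/-- The congruence on terms generated by the axioms of DMV-algebras. -/
inductive Rel : DMVTerm n → DMVTerm n → Prop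
  | refl (t) : Rel t t
  | symm {s t} : Rel s t → Rel t s
  | trans {s t u} : Rel s t → Rel t u → Rel s u
  | add_congr {s s' t t'} : Rel s s' → Rel t t' → Rel (add s t) (add s' t')
  | compl_congr {t t'} : Rel t t' → Rel (compl t) (compl t')
  | delta_congr (k : ℕ+) {t t'} : Rel t t' → Rel (delta k t) (delta k t')
  | add_assoc (s t u) : Rel (add (add s t) u) (add s (add t u))
  | add_comm (s t) : Rel (add s t) (add t s)
  | add_zero (t) : Rel (add t zero) t
  | compl_compl (t) : Rel (compl (compl t)) t
  | luk (s t) : Rel (add (compl (add (compl s) t)) t) (add (compl (add (compl t) s)) s)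
  | compl_zero_add (t) : Rel (add (compl zero) t) (compl zero)
  | nmul_delta (k : ℕ+) (t) : Rel (nmul k (delta k t)) t
  | delta_odot (k : ℕ+) (t) : Rel (odot (delta k t) (nmul ((k : ℕ) - 1) (delta k t))) zero

def setoid (n : ℕ) : Setoid (DMVTerm n) := ⟨Rel, Rel.refl, Rel.symm, Rel.trans⟩

end DMVTerm

/-- The free DMV-algebra on `n` generators: terms modulo the equational consequences of the
axioms. -/
def FreeDMV (n : ℕ) : Type := Quotient (DMVTerm.setoid n)

namespace FreeDMV

variable {n : ℕ}

def mk (t : DMVTerm n) : FreeDMV n := Quotient.mk (DMVTerm.setoid n) t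

/-- The free generators. -/
def gen (i : Fin n) : FreeDMV n := mk (DMVTerm.var i)

instance instZero : Zero (FreeDMV n) := ⟨mk DMVTerm.zero⟩

instance instAdd : Add (FreeDMV n) :=
  ⟨Quotient.map₂ DMVTerm.add (fun _ _ h _ _ h' => DMVTerm.Rel.add_congr h h')⟩

instance instMV : MVAlgebra (FreeDMV n) where
  nsmul := nsmulRec
  compl := Quotient.map DMVTerm.compl (fun _ _ h => DMVTerm.Rel.compl_congr h)
  add_assoc := by
    rintro ⟨x⟩ ⟨y⟩ ⟨z⟩
    exact Quotient.sound (DMVTerm.Rel.add_assoc x y z)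
  zero_add := by
    rintro ⟨x⟩
    exact Quotient.sound ((DMVTerm.Rel.add_comm _ _).trans (DMVTerm.Rel.add_zero x))
  add_zero := by
    rintro ⟨x⟩
    exact Quotient.sound (DMVTerm.Rel.add_zero x)
  add_comm := by
    rintro ⟨x⟩ ⟨y⟩
    exact Quotient.sound (DMVTerm.Rel.add_comm x y)
  compl_invol := by
    rintro ⟨x⟩
    exact Quotient.sound (DMVTerm.Rel.compl_compl x)
  luk := by
    rintro ⟨x⟩ ⟨y⟩
    exact Quotient.sound (DMVTerm.Rel.luk x y)
  compl_zero_add := by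
    rintro ⟨x⟩
    exact Quotient.sound (DMVTerm.Rel.compl_zero_add x)

theorem mk_nmul (k : ℕ) (t : DMVTerm n) : mk (DMVTerm.nmul k t) = k • mk t := by
  induction k with
  | zero => exact (zero_nsmul _).symm
  | succ k ih =>
    rw [succ_nsmul, ← ih]
    rfl

instance instDMV : DMVAlgebra (FreeDMV n) where
  delta k := Quotient.map (DMVTerm.delta k) (fun _ _ h => DMVTerm.Rel.delta_congr k h)
  nsmul_delta := by
    rintro k ⟨x⟩
    exact (mk_nmul (k : ℕ) (DMVTerm.delta k x)).symm.trans
      (Quotient.sound (DMVTerm.Rel.nmul_delta k x))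
  delta_odot := by
    rintro k ⟨x⟩
    have h : mk (DMVTerm.odot (DMVTerm.delta k x)
        (DMVTerm.nmul ((k : ℕ) - 1) (DMVTerm.delta k x))) = mk DMVTerm.zero :=
      Quotient.sound (DMVTerm.Rel.delta_odot k x)
    change MVAlgebra.odot (mk (DMVTerm.delta k x))
      (((k : ℕ) - 1) • mk (DMVTerm.delta k x)) = mk DMVTerm.zero
    rw [← h, ← mk_nmul]
    rfl

end FreeDMV

/-- A DMV-algebra is finitely presented if it is isomorphic to the quotient of a finitely
generated free DMV-algebra by a finitely generated ideal. -/
def IsFinitelyPresentedDMV (D : Type*) [DMVAlgebra D] : Prop :=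
  ∃ (n : ℕ) (J : MVIdeal (FreeDMV n)), J.IsFinitelyGenerated ∧ Nonempty (DMVIso D J.Quot)

/-! ### Rational polyhedra and piecewise linear functions on the cube `[0,1]^n` -/

/-- A rational simplex in `[0,1]^n`: the convex hull of `m + 1` affinely independent points of
`[0,1]^n` with rational coordinates. -/
def IsRationalSimplex {n : ℕ} (S : Set (Fin n → unitInterval)) : Prop :=
  ∃ (m : ℕ) (v : Fin (m + 1) → Fin n → ℝ), AffineIndependent ℝ v ∧
    (∀ i j, v i j ∈ unitInterval ∧ ∃ q : ℚ, v i j = q) ∧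
    S = {x | (fun j => (x j : ℝ)) ∈ convexHull ℝ (Set.range v)}

/-- A rational polyhedron in `[0,1]^n`: a union of finitely many rational simplexes. -/
def IsRationalPolyhedron {n : ℕ} (P : Set (Fin n → unitInterval)) : Prop :=
  ∃ T : Set (Set (Fin n → unitInterval)), T.Finite ∧ (∀ S ∈ T, IsRationalSimplex S) ∧ P = ⋃₀ T

/-- Piecewise linear functions `[0,1]^n → [0,1]` with rational coefficients: continuous functions
which at every point agree with one of finitely many affine functions
`c + a_1 x_1 + ... + a_n x_n` with rational coefficients. -/
def IsRationalPL {n : ℕ} (f : (Fin n → unitInterval) → unitInterval) : Prop :=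
  Continuous f ∧ ∃ L : Set (ℚ × (Fin n → ℚ)), L.Finite ∧
    ∀ x, ∃ l ∈ L, (f x : ℝ) = l.1 + ∑ i, (l.2 i : ℝ) * (x i : ℝ)

/-- The set `DMV_n|_P` of the restrictions to `P ⊆ [0,1]^n` of the piecewise linear functions
`[0,1]^n → [0,1]` with rational coefficients. -/
structure PLRestrict {n : ℕ} (P : Set (Fin n → unitInterval)) where
  val : P → unitInterval
  isRestriction : ∃ f : (Fin n → unitInterval) → unitInterval, IsRationalPL f ∧ ∀ x : P, val x = f x

/-- `min (x + y) 1` on `[0,1]`. -/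
def unitAdd (x y : unitInterval) : unitInterval :=
  ⟨min (x + y : ℝ) 1, le_min (add_nonneg x.2.1 y.2.1) zero_le_one, min_le_right _ _⟩

/-- `x / k` on `[0,1]`. -/
noncomputable def unitDiv (k : ℕ+) (x : unitInterval) : unitInterval :=
  ⟨(x : ℝ) / (k : ℕ), div_nonneg x.2.1 (Nat.cast_nonneg _),
    div_le_one_of_le₀ (x.2.2.trans (by exact_mod_cast k.pos)) (Nat.cast_nonneg _)⟩

namespace IsRationalPL

variable {n : ℕ} {f g : (Fin n → unitInterval) → unitInterval}

theorem zero : IsRationalPL (fun _ : Fin n → unitInterval => (0 : unitInterval)) :=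
  ⟨continuous_const, {0}, Set.finite_singleton _, fun x => ⟨0, rfl, by simp⟩⟩

theorem add (hf : IsRationalPL f) (hg : IsRationalPL g) :
    IsRationalPL (fun x => unitAdd (f x) (g x)) := by
  obtain ⟨cf, L, hL, hf⟩ := hf
  obtain ⟨cg, M, hM, hg⟩ := hg
  refine ⟨?_, insert (1, 0) (Set.image2 (· + ·) L M), (hL.image2 _ hM).insert _, fun x => ?_⟩
  · unfold unitAdd
    fun_prop
  · obtain ⟨l, hl, el⟩ := hf x
    obtain ⟨m, hm, em⟩ := hg x
    rcases le_total ((f x : ℝ) + g x) 1 with h | h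
    · refine ⟨l + m, Set.mem_insert_of_mem _ ⟨l, hl, m, hm, rfl⟩, ?_⟩
      change min ((f x : ℝ) + g x) 1 = _
      rw [min_eq_left h, el, em]
      simp only [Prod.fst_add, Prod.snd_add, Pi.add_apply, Rat.cast_add, add_mul,
        Finset.sum_add_distrib]
      ring
    · refine ⟨(1, 0), Set.mem_insert _ _, ?_⟩
      change min ((f x : ℝ) + g x) 1 = _
      rw [min_eq_right h]
      simp

theorem symm (hf : IsRationalPL f) : IsRationalPL (fun x => unitInterval.symm (f x)) := by
  obtain ⟨cf, L, hL, hf⟩ := hf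
  refine ⟨by fun_prop, (fun l => (1 - l.1, -l.2)) '' L, hL.image _, fun x => ?_⟩
  obtain ⟨l, hl, el⟩ := hf x
  refine ⟨_, ⟨l, hl, rfl⟩, ?_⟩
  simp only [unitInterval.coe_symm_eq, el, Pi.neg_apply, Rat.cast_neg, Rat.cast_sub,
    Rat.cast_one, neg_mul, Finset.sum_neg_distrib]
  ring

theorem div (k : ℕ+) (hf : IsRationalPL f) : IsRationalPL (fun x => unitDiv k (f x)) := by
  obtain ⟨cf, L, hL, hf⟩ := hf
  refine ⟨?_, (fun l => (l.1 / (k : ℕ), fun i => l.2 i / (k : ℕ))) '' L, hL.image _,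
    fun x => ?_⟩
  · unfold unitDiv
    fun_prop
  · obtain ⟨l, hl, el⟩ := hf x
    refine ⟨_, ⟨l, hl, rfl⟩, ?_⟩
    change (f x : ℝ) / (k : ℕ) = _
    simp only [el, Rat.cast_div, Rat.cast_natCast, add_div, Finset.sum_div]
    congr 1
    exact Finset.sum_congr rfl fun i _ => by ring

end IsRationalPL

namespace PLRestrict

variable {n : ℕ} {P : Set (Fin n → unitInterval)}

theorem ext' {f g : PLRestrict P} (h : ∀ x, (f.1 x : ℝ) = g.1 x) : f = g := by
  obtain ⟨f, _⟩ := f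
  obtain ⟨g, _⟩ := g
  have : f = g := funext fun x => Subtype.ext (h x)
  subst this
  rfl

instance instZero : Zero (PLRestrict P) := ⟨⟨fun _ => 0, fun _ => 0, IsRationalPL.zero, fun _ => rfl⟩⟩

instance instAdd : Add (PLRestrict P) where
  add f g := ⟨fun x => unitAdd (f.1 x) (g.1 x), by
    obtain ⟨f', hf, ef⟩ := f.2
    obtain ⟨g', hg, eg⟩ := g.2
    exact ⟨_, hf.add hg, fun x => by rw [ef, eg]⟩⟩

/-- The pointwise MV-algebra structure: `x ⊕ y = min (x + y) 1` and `x* = 1 - x`. -/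
instance instMV : MVAlgebra (PLRestrict P) where
  nsmul := nsmulRec
  compl f := ⟨fun x => unitInterval.symm (f.1 x), by
    obtain ⟨f', hf, ef⟩ := f.2
    exact ⟨_, hf.symm, fun x => by rw [ef]⟩⟩
  add_assoc f g h := ext' fun x => by
    change min (min ((f.1 x : ℝ) + g.1 x) 1 + h.1 x) 1 = min (f.1 x + min ((g.1 x : ℝ) + h.1 x) 1) 1
    have hf := (f.1 x).2
    have hh := (h.1 x).2
    grind
  zero_add f := ext' fun x => by
    change min ((0 : ℝ) + f.1 x) 1 = f.1 x
    rw [zero_add, min_eq_left (f.1 x).2.2]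
  add_zero f := ext' fun x => by
    change min ((f.1 x : ℝ) + 0) 1 = f.1 x
    rw [add_zero, min_eq_left (f.1 x).2.2]
  add_comm f g := ext' fun x => by
    change min ((f.1 x : ℝ) + g.1 x) 1 = min ((g.1 x : ℝ) + f.1 x) 1
    rw [add_comm]
  compl_invol f := ext' fun x => by
    change 1 - (1 - (f.1 x : ℝ)) = f.1 x
    ring
  luk f g := ext' fun x => by
    change min ((1 - min ((1 - (f.1 x : ℝ)) + g.1 x) 1) + g.1 x) 1 =
      min ((1 - min ((1 - (g.1 x : ℝ)) + f.1 x) 1) + f.1 x) 1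
    have hf := (f.1 x).2
    have hg := (g.1 x).2
    grind
  compl_zero_add f := ext' fun x => by
    change min ((1 - (0 : ℝ)) + f.1 x) 1 = 1 - 0
    have hf := (f.1 x).2.1
    rw [sub_zero]
    exact min_eq_right (by linarith)

theorem nsmul_apply (k : ℕ) (f : PLRestrict P) (x : P) :
    ((k • f).1 x : ℝ) = min (k * (f.1 x : ℝ)) 1 := by
  have hf := (f.1 x).2.1
  induction k with
  | zero =>
    rw [zero_nsmul]
    change (0 : ℝ) = _
    simp
  | succ k ih =>
    rw [succ_nsmul]
    change min (((k • f).1 x : ℝ) + f.1 x) 1 = _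
    rw [ih]
    push_cast
    rw [add_mul, one_mul]
    rcases le_total ((k : ℝ) * (f.1 x : ℝ)) 1 with h | h
    · rw [min_eq_left h]
    · rw [min_eq_right h, min_eq_right (by linarith), min_eq_right (by linarith)]

/-- The DMV-algebra `DMV_n|_P`, with `δ_k f = f / k` pointwise. -/
noncomputable instance instDMV : DMVAlgebra (PLRestrict P) where
  delta k f := ⟨fun x => unitDiv k (f.1 x), by
    obtain ⟨f', hf, ef⟩ := f.2
    exact ⟨_, hf.div k, fun x => by rw [ef]⟩⟩
  nsmul_delta k f := ext' fun x => by
    rw [nsmul_apply]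
    change min ((k : ℕ) * ((f.1 x : ℝ) / (k : ℕ))) 1 = _
    have hk : ((k : ℕ) : ℝ) ≠ 0 := by exact_mod_cast k.ne_zero
    rw [mul_div_cancel₀ _ hk, min_eq_left (f.1 x).2.2]
  delta_odot k f := ext' fun x => by
    generalize hg : (⟨fun x => unitDiv k (f.1 x), _⟩ : PLRestrict P) = g
    change 1 - min ((1 - (g.1 x : ℝ)) + (1 - (((k : ℕ) - 1) • g).1 x)) 1 = 0
    rw [nsmul_apply]
    have hgx : (g.1 x : ℝ) = (f.1 x : ℝ) / (k : ℕ) := by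
      rw [← hg]
      rfl
    have hk1 : 1 ≤ (k : ℕ) := k.pos
    have hk : (0 : ℝ) < (k : ℕ) := by exact_mod_cast k.pos
    have h1 : (k : ℕ) * (g.1 x : ℝ) ≤ 1 := by
      rw [hgx, mul_div_cancel₀ _ hk.ne']
      exact (f.1 x).2.2
    have h2 := min_le_left ((((k : ℕ) - 1 : ℕ) : ℝ) * (g.1 x : ℝ)) 1
    rw [Nat.cast_sub hk1, Nat.cast_one] at *
    rw [min_eq_right, sub_self]
    nlinarith

end PLRestrict

/-! Everything rests on a completeness statement, `FreeDMV.mem_span_of_zeros`: an element whose term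
function vanishes on the zero set `Z` of `g` in the real cube lies in the ideal generated by `g`.
The converse is clear, so a principal ideal is exactly the kernel of the restriction map to
functions on `Z`. Vanishing at one point of `Z` defines a maximal ideal, because the reals are
Archimedean; thus the kernel is an intersection of maximal ideals. The restriction map is onto
`PLRestrict Z` by McNaughton's theorem (`DMVTerm.exists_value_eq`), and `Z` is a rational polyhedron
because terms are piecewise affine (`DMVTerm.isRationalPolyhedron_zeros`). Finitely presented
algebras reduce to this case, since a finitely generated ideal is generated by the sum of its
generators.

For completeness, suppose that `f` is outside the ideal. Some prime ideal contains `g` and not `f`,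
and its quotient is totally ordered. By `DMVAlgebra.exists_embedding_ordered_module` this quotient
embeds in an interval `[0, u]` of an ordered rational vector space `W`. There `g` vanishes and `f`
is positive at the point given by the generators. These facts, together with membership in the cube,
amount to finitely many sign conditions on rational affine forms; by Fourier-Motzkin elimination
(`exists_real_same_pos`) they can also be met by a real point. This point contradicts the assumption
on zero sets. -/

/-! ### Disjoint elements, prime ideals and totally ordered quotients -/

namespace MVAlgebra

variable {A : Type*} [MVAlgebra A]

theorem le_one' (x : A) : x ≤ (0 : A)ᶜ := by
  rw [le_iff, add_comm, compl_zero_add]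

/-- By residuation `x ⊙ (k y)*` is below `y`, and it is also below `x`, so it vanishes by
disjointness. One copy of `y` can therefore be dropped at a time. -/
theorem eq_zero_of_le_nsmul {x y : A} (hxy : ∀ e, e ≤ x → e ≤ y → e = 0) (k : ℕ)
    (hx : x ≤ k • y) : x = 0 := by
  induction k with
  | zero =>
    rw [zero_nsmul] at hx
    exact le_antisymm hx (zero_le' _)
  | succ k ih =>
    apply ih
    rw [succ_nsmul, ← odot_compl_le_iff] at hx
    exact hxy _ (odot_compl_le _ _) hx

theorem eq_zero_of_le_nsmul_nsmul {x y e : A} (hxy : ∀ e, e ≤ x → e ≤ y → e = 0) (k l : ℕ)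
    (hx : e ≤ k • x) (hy : e ≤ l • y) : e = 0 := by
  refine eq_zero_of_le_nsmul (y := x) (fun d hd hdx => ?_) k hx
  exact eq_zero_of_le_nsmul (fun c hc hcy => hxy c (hc.trans hdx) hcy) l (hd.trans hy)

/-- Prelinearity: the two differences of `x` and `y` are disjoint. -/
theorem eq_zero_of_le_odot_compl {x y e : A} (h1 : e ≤ odot x yᶜ) (h2 : e ≤ odot y xᶜ) :
    e = 0 := by
  obtain ⟨r, hrx, hry, hr⟩ := exists_glb x y
  have key : ∀ s z, r ≤ s → r ≤ z → e ≤ odot s zᶜ → r + e ≤ s ∧ e ≤ rᶜ := by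
    intro s z hs hz he
    have he' : e ≤ odot s rᶜ := he.trans (odot_mono le_rfl (compl_le hz))
    -- With `r` the meet of `x` and `y`, both `x` and `y` dominate the untruncated sum `r + e`, so
    -- `r + e ≤ r` and cancellation gives `e = 0`.
    refine ⟨?_, he'.trans ?_⟩
    · have h := eq_add_of ((le_iff _ _).1 hs)
      rw [h]
      refine add_mono le_rfl ?_
      rwa [odot, compl_invol] at he'
    · rw [odot, compl_invol]
      exact compl_le (by rw [add_comm]; exact le_add _ _)
  have hx := key x y hrx hry h1
  have hy := key y x hry hrx h2
  rw [← odot_cancel hx.2]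
  exact (le_def _ _).1 (hr _ hx.1 hy.1)

end MVAlgebra

namespace MVIdeal

open MVAlgebra

section MV

variable {A : Type*} [MVAlgebra A]

theorem nsmul_mem (I : MVIdeal A) {x : A} (hx : x ∈ I) (k : ℕ) : k • x ∈ I := by
  induction k with
  | zero => rw [zero_nsmul]; exact I.zero_mem
  | succ k ih => rw [succ_nsmul]; exact I.add_mem ih hx

theorem mem_of_one_mem (I : MVIdeal A) (h : (0 : A)ᶜ ∈ I) (x : A) : x ∈ I :=
  I.lower (le_one' x) h

theorem subset_span (S : Set A) : S ⊆ (span S : Set A) := fun _ hx _ hI => hI hx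

/-- The ideal generated by an ideal `K` and an element `a`. -/
def adjoin (K : MVIdeal A) (a : A) : MVIdeal A where
  carrier := {x | ∃ p ∈ K, ∃ m : ℕ, x ≤ p + m • a}
  zero_mem' := ⟨0, K.zero_mem, 0, zero_le' _⟩
  add_mem' := by
    rintro x y ⟨p, hp, m, hx⟩ ⟨q, hq, l, hy⟩
    refine ⟨p + q, K.add_mem hp hq, m + l, (add_mono hx hy).trans (le_of_eq ?_)⟩
    rw [add_nsmul, add_add_add_comm]
  mem_of_le := fun h ⟨p, hp, m, hy⟩ => ⟨p, hp, m, h.trans hy⟩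

theorem self_mem_adjoin (K : MVIdeal A) (a : A) : a ∈ K.adjoin a :=
  ⟨0, K.zero_mem, 1, by rw [zero_add, one_nsmul]⟩

theorem subset_adjoin (K : MVIdeal A) (a : A) : (K : Set A) ⊆ K.adjoin a :=
  fun x hx => ⟨x, hx, 0, le_add _ _⟩

/-- The sum of the generators generates the same ideal, since each generator lies below it. -/
theorem IsFinitelyGenerated.isPrincipal {J : MVIdeal A} (h : J.IsFinitelyGenerated) :
    J.IsPrincipal := by
  classical
  obtain ⟨S, hS, rfl⟩ := h
  refine ⟨∑ x ∈ hS.toFinset, x, SetLike.ext fun x => ?_⟩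
  refine forall_congr' fun I => imp_congr_left ?_
  rw [Set.singleton_subset_iff]
  constructor
  · intro h
    exact sum_mem (S := I.toAddSubmonoid) fun x hx => h (hS.mem_toFinset.1 hx)
  · intro h x hx
    refine I.lower ?_ h
    rw [← Finset.add_sum_erase _ _ (hS.mem_toFinset.2 hx)]
    exact le_add _ _

/-- An element outside an ideal is outside some prime ideal containing it. -/
theorem exists_prime (J : MVIdeal A) {f : A} (hf : f ∉ J) :
    ∃ P : MVIdeal A, (J : Set A) ⊆ P ∧ f ∉ P ∧ ∀ x y, odot x yᶜ ∈ P ∨ odot y xᶜ ∈ P := by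
  obtain ⟨M, hJM, hM⟩ := zorn_subset_nonempty
    {I : Set A | ∃ K : MVIdeal A, (K : Set A) = I ∧ f ∉ K} (by
      intro c hc hchain hne
      refine ⟨⋃₀ c, ⟨⟨⟨⟨⋃₀ c, ?_⟩, ?_⟩, ?_⟩, rfl, ?_⟩, fun s hs => Set.subset_sUnion_of_mem hs⟩
      · rintro x y ⟨s, hs, hx⟩ ⟨t, ht, hy⟩
        obtain ⟨u, hu, hsu, htu⟩ := hchain.directedOn s hs t ht
        obtain ⟨K, hK, -⟩ := hc hu
        have hx' := hsu hx
        have hy' := htu hy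
        rw [← hK] at hx' hy'
        exact ⟨u, hu, hK ▸ K.add_mem hx' hy'⟩
      · obtain ⟨s, hs⟩ := hne
        obtain ⟨K, hK, -⟩ := hc hs
        exact ⟨s, hs, hK ▸ K.zero_mem⟩
      · rintro x y hxy ⟨s, hs, hy⟩
        obtain ⟨K, hK, -⟩ := hc hs
        rw [← hK] at hy
        exact ⟨s, hs, hK ▸ K.lower hxy hy⟩
      · rintro ⟨s, hs, hy⟩
        obtain ⟨K, hK, hfK⟩ := hc hs
        rw [← hK] at hy
        exact hfK hy) (J : Set A) ⟨J, rfl, hf⟩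
  obtain ⟨K, rfl, hfK⟩ := hM.prop
  refine ⟨K, hJM, hfK, fun x y => ?_⟩
  -- If both differences were outside `K`, maximality would put `f` below `p + m (x ⊙ y*)` and below
  -- `q + l (y ⊙ x*)` with `p, q ∈ K`. Then `f ⊙ (p + q)*` is below multiples of two disjoint
  -- elements, hence zero, and `f ≤ p + q` lies in `K`.
  by_contra! hxy
  have key : ∀ a, a ∉ K → f ∈ K.adjoin a := by
    intro a ha
    by_contra hfa
    exact ha (hM.le_of_ge ⟨K.adjoin a, rfl, hfa⟩ (subset_adjoin K a) (self_mem_adjoin K a))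
  obtain ⟨p, hp, m, h1⟩ := key _ hxy.1
  obtain ⟨q, hq, l, h2⟩ := key _ hxy.2
  have e1 : odot f (p + q)ᶜ ≤ m • odot x yᶜ := by
    rw [odot_compl_le_iff]
    exact h1.trans (add_mono (le_add _ _) le_rfl)
  have e2 : odot f (p + q)ᶜ ≤ l • odot y xᶜ := by
    rw [odot_compl_le_iff, add_comm p]
    exact h2.trans (add_mono (le_add _ _) le_rfl)
  have := eq_zero_of_le_nsmul_nsmul (fun e => eq_zero_of_le_odot_compl) m l e1 e2
  exact hfK (K.lower ((le_def _ _).2 this) (K.add_mem hp hq))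

theorem toQuot_eq_zero_iff (J : MVIdeal A) (x : A) : J.toQuot x = 0 ↔ x ∈ J := by
  have h0 : odot x (0 : A)ᶜ = x := by rw [odot, compl_invol, add_zero, compl_invol]
  have h1 : odot (0 : A) xᶜ = 0 := zero_le' x
  constructor
  · intro h
    have := (Quotient.exact (s := J.setoid) h).1
    rwa [h0] at this
  · intro h
    refine Quotient.sound (s := J.setoid) ⟨?_, ?_⟩
    · rwa [h0]
    · rw [h1]; exact J.zero_mem

theorem quot_le_total {J : MVIdeal A} (h : ∀ x y, odot x yᶜ ∈ J ∨ odot y xᶜ ∈ J) (x y : J.Quot) :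
    x ≤ y ∨ y ≤ x := by
  obtain ⟨x, rfl⟩ := J.toQuot_surjective x
  obtain ⟨y, rfl⟩ := J.toQuot_surjective y
  exact (h x y).imp ((toQuot_eq_zero_iff J _).2) ((toQuot_eq_zero_iff J _).2)

end MV

end MVIdeal

/-! ### Totally ordered DMV-algebras inside ordered rational vector spaces -/

namespace MVAlgebra

variable {A : Type*} [MVAlgebra A]

instance : IsOrderedAddMonoid A where
  add_le_add_left _ _ h _ := add_mono h le_rfl

theorem le_of_add_le_add_left_of_le_compl {x y z : A} (hx : x ≤ zᶜ) (hy : y ≤ zᶜ)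
    (h : z + x ≤ z + y) : x ≤ y := by
  rw [← odot_cancel hx, ← odot_cancel hy]
  exact odot_mono h le_rfl

end MVAlgebra

namespace DMVAlgebra

open MVAlgebra Filter

variable {C : Type*} [DMVAlgebra C]

/-- Division by two. -/
def half (x : C) : C := delta 2 x

theorem half_add_half (x : C) : half x + half x = x := by
  rw [← two_nsmul]
  exact nsmul_delta 2 x

theorem half_le_compl_half (x : C) : half x ≤ (half x)ᶜ := by
  have h := le_compl_of_odot (delta_odot 2 x)
  change half x ≤ (1 • half x)ᶜ at h
  rwa [one_nsmul] at h

theorem half_le (x : C) : half x ≤ x := by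
  conv_rhs => rw [← half_add_half x]
  exact le_add _ _

theorem half_le_compl {x y : C} (h : x ≤ yᶜ) : half x ≤ (half y)ᶜ :=
  (half_le x).trans (h.trans (compl_le (half_le y)))

/-- Both sides are halves of `x + y`, and division by two is unique. Uniqueness requires the sum of
the halves to be at most its own complement, which is where `x ≤ yᶜ` enters. -/
theorem half_add {x y : C} (h : x ≤ yᶜ) : half (x + y) = half x + half y := by
  have e : 2 • (half x + half y) = x + y := by
    rw [nsmul_add, two_nsmul, two_nsmul, half_add_half, half_add_half]
  refine divisor_unique (n := 2) two_pos (delta_odot 2 _) ?_ ((nsmul_delta 2 (x + y)).trans e.symm)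
  change odot _ (1 • _) = 0
  have hd : half x + half y ≤ (half x + half y)ᶜ :=
    defined_shuffle (half_le_compl_half x) (half_le_compl_half y)
      (by rwa [half_add_half, half_add_half])
  rw [one_nsmul]
  simpa only [compl_invol] using (MVAlgebra.le_def _ _).1 hd

theorem iterate_half_add (k : ℕ) {x y : C} (h : x ≤ yᶜ) :
    half^[k] (x + y) = half^[k] x + half^[k] y := by
  induction k generalizing x y with
  | zero => rfl
  | succ k ih =>
    simp only [Function.iterate_succ_apply]
    rw [half_add h, ih (half_le_compl h)]

theorem two_pow_nsmul_iterate_half (k : ℕ) (x : C) : 2 ^ k • half^[k] x = x := by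
  induction k with
  | zero => rw [pow_zero, one_nsmul]; rfl
  | succ k ih =>
    rw [pow_succ, mul_nsmul', two_nsmul, Function.iterate_succ_apply', half_add_half, ih]

theorem iterate_half_mono (k : ℕ) {x y : C} (h : x ≤ y) : half^[k] x ≤ half^[k] y := by
  have e := eq_add_of ((le_iff _ _).1 h)
  rw [e, iterate_half_add]
  · exact le_add _ _
  · rw [compl_invol, add_comm]
    exact le_add _ _

/-- Both multiples of `1 / 2 ^ (k + 1)` are at most one half, so their sum is not truncated. -/
theorem nsmul_iterate_half_le_compl (m l k : ℕ) (hm : m ≤ 2 ^ k) (hl : l ≤ 2 ^ k) :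
    m • half^[k + 1] (0 : C)ᶜ ≤ (l • half^[k + 1] (0 : C)ᶜ)ᶜ := by
  have key : ∀ j ≤ 2 ^ k, j • half^[k + 1] (0 : C)ᶜ ≤ half (0 : C)ᶜ := by
    intro j hj
    refine (nsmul_mono hj).trans (le_of_eq ?_)
    rw [Function.iterate_succ_apply, two_pow_nsmul_iterate_half]
  exact (key m hm).trans ((half_le_compl_half _).trans (compl_le (key l hl)))

variable (C) in
/-- Germs of sequences `s` in `C` with `s k ≤ N / 2 ^ k` for some `N`: sums of such germs are not
truncated. -/
noncomputable def smallGerms : AddSubmonoid (Germ (hyperfilter ℕ : Filter ℕ) C) where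
  carrier := {g | ∃ N : ℕ, g ≤ N • ((fun k => half^[k] (0 : C)ᶜ : ℕ → C) : Germ _ C)}
  zero_mem' := ⟨0, by rw [zero_nsmul]⟩
  add_mem' := by
    rintro g h ⟨m, hg⟩ ⟨l, hh⟩
    exact ⟨m + l, by rw [add_nsmul]; exact add_le_add hg hh⟩

theorem mem_smallGerms_coe {s : ℕ → C} : (s : Germ (hyperfilter ℕ : Filter ℕ) C) ∈ smallGerms C ↔
    ∃ N : ℕ, ∀ᶠ k in (hyperfilter ℕ : Filter ℕ), s k ≤ N • half^[k] (0 : C)ᶜ := Iff.rfl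

theorem eventually_le_compl {s t : ℕ → C}
    (hs : (s : Germ (hyperfilter ℕ : Filter ℕ) C) ∈ smallGerms C)
    (ht : (t : Germ (hyperfilter ℕ : Filter ℕ) C) ∈ smallGerms C) :
    ∀ᶠ k in (hyperfilter ℕ : Filter ℕ), s k ≤ (t k)ᶜ := by
  obtain ⟨m, hm⟩ := mem_smallGerms_coe.1 hs
  obtain ⟨l, hl⟩ := mem_smallGerms_coe.1 ht
  -- The bound on `k` ensures that `j = k - 1` satisfies `m, l ≤ 2 ^ j`.
  filter_upwards [hm, hl, Nat.hyperfilter_le_atTop (eventually_ge_atTop (m + l + 1))]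
    with k hk1 hk2 hk3
  obtain ⟨j, rfl⟩ : ∃ j, k = j + 1 := ⟨k - 1, by omega⟩
  have := (Nat.lt_two_pow_self (n := j)).le
  exact hk1.trans ((nsmul_iterate_half_le_compl m l j (by omega) (by omega)).trans (compl_le hk2))

/-- Truncation is the only obstruction to cancellation, and small germs never reach it. This makes
the passage to the group of differences injective. -/
instance : IsOrderedCancelAddMonoid (smallGerms C) where
  add_le_add_left := fun a b h c => add_le_add_left (α := Germ (hyperfilter ℕ : Filter ℕ) C) h c
  le_of_add_le_add_left := by
    rintro ⟨a, ha⟩ ⟨b, hb⟩ ⟨c, hc⟩ h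
    induction a using Germ.inductionOn with | _ a =>
    induction b using Germ.inductionOn with | _ b =>
    induction c using Germ.inductionOn with | _ c =>
    have h' : ∀ᶠ k in (hyperfilter ℕ : Filter ℕ), a k + b k ≤ a k + c k := h
    change ∀ᶠ k in (hyperfilter ℕ : Filter ℕ), b k ≤ c k
    filter_upwards [h', eventually_le_compl hb ha, eventually_le_compl hc ha] with k h1 h2 h3
    exact le_of_add_le_add_left_of_le_compl h2 h3 h1

/-- Comparability holds at every index, and an ultrafilter decides which of the two inequalities
holds for the germs. -/
noncomputable instance [Std.Total ((· ≤ ·) : C → C → Prop)] : LinearOrder (smallGerms C) :=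
  { (inferInstance : PartialOrder (smallGerms C)) with
    le_total := by
      rintro ⟨a, ha⟩ ⟨b, hb⟩
      induction a using Germ.inductionOn with | _ a =>
      induction b using Germ.inductionOn with | _ b =>
      exact Ultrafilter.eventually_or.1
        (Eventually.of_forall fun k => Std.Total.total (r := ((· ≤ ·) : C → C → Prop)) (a k) (b k))
    toDecidableLE := Classical.decRel _ }

/-- The germ of the sequence `x / 2 ^ k`. -/
noncomputable def toSmallGerms (x : C) : smallGerms C :=
  ⟨((fun k => half^[k] x : ℕ → C) : Germ _ C), 1, by
    rw [one_nsmul]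
    exact Eventually.of_forall fun k => iterate_half_mono k (le_one' x)⟩

theorem toSmallGerms_add {x y : C} (h : x ≤ yᶜ) :
    toSmallGerms (x + y) = toSmallGerms x + toSmallGerms y :=
  Subtype.ext (congrArg (Germ.ofFun (l := (hyperfilter ℕ : Filter ℕ)))
    (funext fun k => iterate_half_add k h))

theorem toSmallGerms_le {x y : C} (h : x ≤ y) : toSmallGerms x ≤ toSmallGerms y :=
  show ∀ᶠ k in (hyperfilter ℕ : Filter ℕ), half^[k] x ≤ half^[k] y from
    Eventually.of_forall fun k => iterate_half_mono k h

/-- Agreement at a single index `k` suffices: multiplication by `2 ^ k` recovers the elements. -/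
theorem toSmallGerms_injective : Function.Injective (toSmallGerms (C := C)) := by
  intro x y h
  have h' : ∀ᶠ k in (hyperfilter ℕ : Filter ℕ), half^[k] x = half^[k] y :=
    Germ.coe_eq.1 (congrArg Subtype.val h)
  obtain ⟨k, hk⟩ := h'.exists
  rw [← two_pow_nsmul_iterate_half k x, hk, two_pow_nsmul_iterate_half]

/-- A totally ordered DMV-algebra is an interval `[0, u]` in a totally ordered rational vector
space. -/
theorem exists_embedding_ordered_module (C : Type) [DMVAlgebra C]
    (htot : ∀ x y : C, x ≤ y ∨ y ≤ x) :
    ∃ (W : Type) (_ : AddCommGroup W) (_ : LinearOrder W) (_ : IsOrderedAddMonoid W)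
      (_ : Module ℚ W) (_ : IsStrictOrderedModule ℚ W) (u : W) (ι : C → W),
      Function.Injective ι ∧ ι 0 = 0 ∧ (∀ x, 0 ≤ ι x) ∧ (∀ x y, ι (x + y) = min (ι x + ι y) u) ∧
      (∀ x, ι xᶜ = u - ι x) ∧ ∀ k x, ι (delta k x) = ((k : ℕ) : ℚ)⁻¹ • ι x := by
  have : Std.Total ((· ≤ ·) : C → C → Prop) := ⟨htot⟩
  let G := Algebra.GrothendieckAddGroup (smallGerms C)
  have hG : IsOrderedAddMonoid G := (inferInstance : IsOrderedCancelAddMonoid G).toIsOrderedAddMonoid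
  let ι : C → DivisibleHull G := fun x =>
    DivisibleHull.coeAddMonoidHom G (Algebra.GrothendieckAddGroup.of (toSmallGerms x))
  have hadd : ∀ x y : C, x ≤ yᶜ → ι (x + y) = ι x + ι y := by
    intro x y h
    simp only [ι, toSmallGerms_add h, map_add]
  have hinj : Function.Injective ι := DivisibleHull.coe_injective.comp
    (Algebra.GrothendieckAddGroup.of_injective.comp toSmallGerms_injective)
  have hzero : ι 0 = 0 := by
    have h := hadd 0 0 (zero_le' _)
    rw [add_zero] at h
    exact left_eq_add.1 h
  have hmono : ∀ x y : C, x ≤ y → ι x ≤ ι y := by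
    intro x y h
    have h1 : (Algebra.GrothendieckAddGroup.of (toSmallGerms x) : G) ≤
        Algebra.GrothendieckAddGroup.of (toSmallGerms y) :=
      (AddLocalization.mkOrderEmbedding (s := (⊤ : AddSubmonoid (smallGerms C))) 0).monotone
        (toSmallGerms_le h)
    exact (DivisibleHull.coeOrderAddMonoidHom G).monotone' h1
  have hcompl : ∀ x, ι xᶜ = ι (0 : C)ᶜ - ι x := by
    intro x
    rw [← compl_add_self x, hadd _ _ le_rfl, add_sub_cancel_right]
  have hnonneg : ∀ x, 0 ≤ ι x := fun x => hzero ▸ hmono _ _ (zero_le' x)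
  refine ⟨DivisibleHull G, inferInstance, inferInstance, inferInstance, inferInstance,
    inferInstance, ι (0 : C)ᶜ, ι, hinj, hzero, hnonneg, fun x y => ?_, hcompl, fun k x => ?_⟩
  -- Totality leaves two cases: the sum is untruncated, or `yᶜ ≤ x` and the sum is the top element.
  · rcases htot x yᶜ with h | h
    · rw [hadd _ _ h, min_eq_left]
      rw [← hadd _ _ h]
      exact hmono _ _ (le_one' _)
    · have h1 : x + y = (0 : C)ᶜ := by
        rw [le_iff, compl_invol, add_comm] at h
        exact h
      rw [h1, min_eq_right]
      have h2 := add_le_add_left (hmono _ _ h) (ι y)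
      rwa [hcompl, sub_add_cancel] at h2
  -- The axiom `δ_k x ⊙ (k - 1) δ_k x = 0` keeps all multiples of `δ_k x` up to the `k`-th
  -- untruncated.
  · have key : ∀ j ≤ (k : ℕ), ι (j • delta k x) = j • ι (delta k x) := by
      intro j
      induction j with
      | zero => intro _; rw [zero_nsmul, zero_nsmul, hzero]
      | succ j ih =>
        intro hj
        rw [succ_nsmul, succ_nsmul, hadd, ih (by omega)]
        exact (nsmul_mono (by omega : j ≤ (k : ℕ) - 1)).trans
          (le_compl_comm (le_compl_of_odot (delta_odot k x)))
    have h := key k le_rfl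
    rw [nsmul_delta] at h
    rw [h, ← Nat.cast_smul_eq_nsmul ℚ, smul_smul, inv_mul_cancel₀, one_smul]
    exact_mod_cast k.ne_zero

end DMVAlgebra

/-! ### Transfer of sign conditions to the reals -/

/-- A finite set of rational linear forms evaluated at a vector of a totally ordered rational vector
space has the same strict positivity pattern at some real vector. -/
theorem exists_real_same_pos {W : Type*} [AddCommGroup W] [LinearOrder W] [IsOrderedAddMonoid W]
    [Module ℚ W] [IsStrictOrderedModule ℚ W] {n : ℕ} (a : Fin n → W) (T : Set (Fin n → ℚ))
    (hT : T.Finite) :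
    ∃ x : Fin n → ℝ, ∀ t ∈ T, 0 < ∑ i, t i • a i ↔ 0 < ∑ i, t i • x i := by
  induction n with
  | zero => exact ⟨0, fun t _ => by simp⟩
  | succ n ih =>
    -- Fourier-Motzkin elimination of the first variable: for `t 0 ≠ 0`, positivity of `t` says on
    -- which side of `bound t` that variable lies. For `t 0 = 0` the convention `0⁻¹ = 0` makes the
    -- bound zero, a harmless extra form.
    let bound : (Fin (n + 1) → ℚ) → Fin n → ℚ := fun t i => -((t 0)⁻¹ * t i.succ)
    obtain ⟨x, hx⟩ := ih (Fin.tail a) (Fin.tail '' T ∪ Set.image2 (fun s t => bound s - bound t) T T)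
      ((hT.image _).union (hT.image2 _ hT))
    let α : (Fin (n + 1) → ℚ) → W := fun t => ∑ i, bound t i • Fin.tail a i
    let β : (Fin (n + 1) → ℚ) → ℝ := fun t => ∑ i, bound t i • x i
    have hlt : ∀ s ∈ T, ∀ t ∈ T, α s < α t ↔ β s < β t := by
      intro s hs t ht
      have := hx _ (Or.inr ⟨t, ht, s, hs, rfl⟩)
      simpa only [Pi.sub_apply, sub_smul, Finset.sum_sub_distrib, sub_pos] using this
    -- The real bounds `β t` are ordered as the bounds `α t`, so `y` can be placed among them
    -- exactly as `a 0` is among the `α t`: at a bound, or in a gap.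
    obtain ⟨y, hy⟩ : ∃ y : ℝ, ∀ t ∈ T, (α t < a 0 ↔ β t < y) ∧ (a 0 < α t ↔ y < β t) := by
      by_cases h : ∃ t ∈ T, α t = a 0
      · obtain ⟨s, hs, h⟩ := h
        exact ⟨β s, fun t ht => ⟨h ▸ hlt t ht s hs, h ▸ hlt s hs t ht⟩⟩
      · push Not at h
        obtain ⟨y, hlo, hhi⟩ := Order.exists_between_finsets
          (((hT.subset (Set.sep_subset T fun t => α t < a 0)).image β).toFinset)
          (((hT.subset (Set.sep_subset T fun t => a 0 < α t)).image β).toFinset) (by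
            intro p hp q hq
            obtain ⟨s, ⟨hs, hs'⟩, rfl⟩ := (Set.Finite.mem_toFinset _).1 hp
            obtain ⟨t, ⟨ht, ht'⟩, rfl⟩ := (Set.Finite.mem_toFinset _).1 hq
            exact (hlt s hs t ht).1 (hs'.trans ht'))
        have hlo' : ∀ t ∈ T, α t < a 0 → β t < y := fun t ht h =>
          hlo _ ((Set.Finite.mem_toFinset _).2 ⟨t, ⟨ht, h⟩, rfl⟩)
        have hhi' : ∀ t ∈ T, a 0 < α t → y < β t := fun t ht h =>
          hhi _ ((Set.Finite.mem_toFinset _).2 ⟨t, ⟨ht, h⟩, rfl⟩)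
        refine ⟨y, fun t ht => ⟨⟨hlo' t ht, fun h' => ?_⟩, ⟨hhi' t ht, fun h' => ?_⟩⟩⟩
        · exact (lt_or_gt_of_ne (h t ht)).resolve_right fun h2 => lt_asymm h' (hhi' t ht h2)
        · exact (lt_or_gt_of_ne (h t ht)).resolve_left fun h2 => lt_asymm h' (hlo' t ht h2)
    refine ⟨Fin.cons y x, fun t ht => ?_⟩
    simp only [Fin.sum_univ_succ, Fin.cons_zero, Fin.cons_succ]
    rcases eq_or_ne (t 0) 0 with h0 | h0
    · rw [h0, zero_smul, zero_smul, zero_add, zero_add]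
      exact hx _ (Or.inl ⟨t, ht, rfl⟩)
    · have hb : ∀ i, t 0 * bound t i = -t i.succ := fun i => by
        simp only [bound, mul_neg, mul_inv_cancel_left₀ h0]
      have e1 : t 0 • a 0 + ∑ i : Fin n, t i.succ • a i.succ = t 0 • (a 0 - α t) := by
        simp only [α, smul_sub, Finset.smul_sum, smul_smul, hb, neg_smul, Finset.sum_neg_distrib,
          sub_neg_eq_add]
        rfl
      have e2 : t 0 • y + ∑ i : Fin n, t i.succ • x i = t 0 • (y - β t) := by
        simp only [β, smul_sub, Finset.smul_sum, smul_smul, hb, neg_smul, Finset.sum_neg_distrib,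
          sub_neg_eq_add]
      rw [e1, e2]
      rcases lt_or_gt_of_ne h0 with h0 | h0
      · rw [smul_pos_iff_of_neg_left h0, smul_pos_iff_of_neg_left h0, sub_neg, sub_neg]
        exact (hy t ht).2
      · rw [smul_pos_iff_of_pos_left h0, smul_pos_iff_of_pos_left h0, sub_pos, sub_pos]
        exact (hy t ht).1

section Affine

variable {W : Type*} [AddCommGroup W] [Module ℚ W] {n : ℕ}

/-- The value `c u + b_1 a_1 + ... + b_n a_n` of the rational affine form `(c, b)`. -/
def affineEval (u : W) (a : Fin n → W) : ℚ × (Fin n → ℚ) →ₗ[ℚ] W :=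
  (LinearMap.toSpanSingleton ℚ W u).coprod (Fintype.linearCombination ℚ a)

theorem affineEval_apply (u : W) (a : Fin n → W) (l : ℚ × (Fin n → ℚ)) :
    affineEval u a l = l.1 • u + ∑ i, l.2 i • a i := rfl

theorem affineEval_one (u : W) (a : Fin n → W) : affineEval u a (1, 0) = u := by
  simp [affineEval_apply]

theorem affineEval_var (u : W) (a : Fin n → W) (i : Fin n) :
    affineEval u a (0, Pi.single i 1) = a i := by
  simp [affineEval_apply, Pi.single_apply, ite_smul]

theorem affineEval_real (x : Fin n → ℝ) (l : ℚ × (Fin n → ℚ)) :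
    affineEval (1 : ℝ) x l = l.1 + ∑ i, (l.2 i : ℝ) * x i := by
  simp [affineEval_apply, Rat.smul_def]

end Affine

/-- Homogenization: `u` becomes an extra coordinate, kept positive by the form `(1, 0)`, and
division by it normalizes `u` to `1`. Adding the negatives of the forms controls the weak
inequalities too. -/
theorem exists_real_same_sign {W : Type*} [AddCommGroup W] [LinearOrder W] [IsOrderedAddMonoid W]
    [Module ℚ W] [IsStrictOrderedModule ℚ W] {n : ℕ} {u : W} (hu : 0 < u) (a : Fin n → W)
    (T : Set (ℚ × (Fin n → ℚ))) (hT : T.Finite) :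
    ∃ x : Fin n → ℝ, ∀ t ∈ T, (0 < affineEval u a t ↔ 0 < affineEval (1 : ℝ) x t) ∧
      (0 ≤ affineEval u a t ↔ 0 ≤ affineEval (1 : ℝ) x t) := by
  let cons : ℚ × (Fin n → ℚ) → Fin (n + 1) → ℚ := fun t => Fin.cons t.1 t.2
  have h1 : ∀ t, ∑ i, cons t i • (Fin.cons u a : Fin (n + 1) → W) i = affineEval u a t := by
    intro t
    simp [cons, Fin.sum_univ_succ, affineEval_apply]
  obtain ⟨y, hy⟩ := exists_real_same_pos (Fin.cons u a : Fin (n + 1) → W)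
    (cons '' (insert (1, 0) (T ∪ -T))) (((hT.union hT.neg).insert _).image _)
  have hy0 : 0 < y 0 := by
    have := hy _ ⟨_, Set.mem_insert _ _, rfl⟩
    rw [h1, affineEval_one] at this
    simpa [cons, Fin.sum_univ_succ] using this.1 hu
  have h2 : ∀ t, ∑ i, cons t i • y i =
      y 0 * affineEval (1 : ℝ) (fun i => y i.succ / y 0) t := by
    intro t
    simp only [cons, Fin.sum_univ_succ, affineEval_real, Fin.cons_zero, Fin.cons_succ, mul_add,
      Finset.mul_sum, Rat.smul_def]
    congr 1
    · ring
    · refine Finset.sum_congr rfl fun i _ => ?_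
      field_simp
  have h3 : ∀ t ∈ T ∪ -T, 0 < affineEval u a t ↔
      0 < affineEval (1 : ℝ) (fun i => y i.succ / y 0) t := by
    intro t ht
    have := hy _ ⟨t, Set.mem_insert_of_mem _ ht, rfl⟩
    rwa [h1, h2, mul_pos_iff_of_pos_left hy0] at this
  refine ⟨_, fun t ht => ⟨h3 t (Or.inl ht), ?_⟩⟩
  have := h3 (-t) (Or.inr (by simpa using ht))
  rw [map_neg, map_neg, neg_pos, neg_pos] at this
  rw [← not_lt, this, not_lt]

/-! ### Term functions and completeness of the real unit interval -/

namespace DMVTerm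

variable {W : Type*} [AddCommGroup W] [LinearOrder W] [Module ℚ W] {n : ℕ}

/-- The value of a term in the interval `[0, u]` of an ordered rational vector space. -/
def value (u : W) (a : Fin n → W) : DMVTerm n → W
  | var i => a i
  | zero => 0
  | add s t => min (value u a s + value u a t) u
  | compl t => u - value u a t
  | delta k t => ((k : ℕ) : ℚ)⁻¹ • value u a t

/-- Term functions are piecewise affine, uniformly in all ordered rational vector spaces. -/
theorem exists_pieces (t : DMVTerm n) :
    ∃ Q : List (List (ℚ × (Fin n → ℚ)) × (ℚ × (Fin n → ℚ))), ∀ (W : Type) [AddCommGroup W]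
      [LinearOrder W] [IsOrderedAddMonoid W] [Module ℚ W] (u : W) (a : Fin n → W),
      (∃ p ∈ Q, ∀ s ∈ p.1, 0 ≤ affineEval u a s) ∧
      ∀ p ∈ Q, (∀ s ∈ p.1, 0 ≤ affineEval u a s) → t.value u a = affineEval u a p.2 := by
  induction t with
  | var i =>
    exact ⟨[([], (0, Pi.single i 1))], fun W _ _ _ _ u a => by simp [affineEval_var, value]⟩
  | zero => exact ⟨[([], 0)], fun W _ _ _ _ u a => by simp [value]⟩
  | compl t ih =>
    obtain ⟨Q, hQ⟩ := ih
    refine ⟨Q.map fun p => (p.1, (1, 0) - p.2), fun W _ _ _ _ u a => ?_⟩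
    obtain ⟨⟨p, hp, hp'⟩, h⟩ := hQ W u a
    refine ⟨⟨_, List.mem_map_of_mem hp, hp'⟩, fun q hq hq' => ?_⟩
    obtain ⟨r, hr, rfl⟩ := List.mem_map.1 hq
    rw [value, h r hr hq', map_sub, affineEval_one]
  | delta k t ih =>
    obtain ⟨Q, hQ⟩ := ih
    refine ⟨Q.map fun p => (p.1, ((k : ℕ) : ℚ)⁻¹ • p.2), fun W _ _ _ _ u a => ?_⟩
    obtain ⟨⟨p, hp, hp'⟩, h⟩ := hQ W u a
    refine ⟨⟨_, List.mem_map_of_mem hp, hp'⟩, fun q hq hq' => ?_⟩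
    obtain ⟨r, hr, rfl⟩ := List.mem_map.1 hq
    rw [value, h r hr hq', map_smul]
  | add s t ihs iht =>
    obtain ⟨Q, hQ⟩ := ihs
    obtain ⟨R, hR⟩ := iht
    refine ⟨Q.flatMap fun p => R.flatMap fun q =>
      [((p.2 + q.2 - (1, 0)) :: (p.1 ++ q.1), (1, 0)),
        (((1, 0) - (p.2 + q.2)) :: (p.1 ++ q.1), p.2 + q.2)], fun W _ _ _ _ u a => ?_⟩
    obtain ⟨⟨p, hp, hp'⟩, h⟩ := hQ W u a
    obtain ⟨⟨q, hq, hq'⟩, k⟩ := hR W u a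
    constructor
    · rcases le_total u (affineEval u a (p.2 + q.2)) with hle | hle
      · refine ⟨((p.2 + q.2 - (1, 0)) :: (p.1 ++ q.1), (1, 0)), List.mem_flatMap.2
          ⟨p, hp, List.mem_flatMap.2 ⟨q, hq, by simp⟩⟩, List.forall_mem_cons.2 ⟨?_, ?_⟩⟩
        · rwa [map_sub, affineEval_one, sub_nonneg]
        · exact List.forall_mem_append.2 ⟨hp', hq'⟩
      · refine ⟨(((1, 0) - (p.2 + q.2)) :: (p.1 ++ q.1), p.2 + q.2), List.mem_flatMap.2
          ⟨p, hp, List.mem_flatMap.2 ⟨q, hq, by simp⟩⟩, List.forall_mem_cons.2 ⟨?_, ?_⟩⟩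
        · rwa [map_sub, affineEval_one, sub_nonneg]
        · exact List.forall_mem_append.2 ⟨hp', hq'⟩
    · intro r hr hr'
      obtain ⟨p, hp, hr⟩ := List.mem_flatMap.1 hr
      obtain ⟨q, hq, hr⟩ := List.mem_flatMap.1 hr
      rw [List.mem_pair] at hr
      rcases hr with rfl | rfl
      · rw [List.forall_mem_cons, List.forall_mem_append, map_sub, affineEval_one, sub_nonneg,
          map_add] at hr'
        rw [value, h p hp hr'.2.1, k q hq hr'.2.2, min_eq_right hr'.1, affineEval_one]
      · rw [List.forall_mem_cons, List.forall_mem_append, map_sub, affineEval_one, sub_nonneg,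
          map_add] at hr'
        rw [value, h p hp hr'.2.1, k q hq hr'.2.2, min_eq_left hr'.1, map_add]

end DMVTerm

/-- Completeness: if the term function of `f` vanishes on the zeros of that of `g` in the real unit
cube, then `f` lies in the ideal generated by `g`. -/
theorem FreeDMV.mem_span_of_zeros {n : ℕ} (f g : DMVTerm n)
    (h : ∀ x : Fin n → ℝ, (∀ i, x i ∈ unitInterval) → g.value 1 x = 0 → f.value 1 x = 0) :
    FreeDMV.mk f ∈ MVIdeal.span {FreeDMV.mk g} := by
  by_contra hf
  obtain ⟨P, hP, hfP, hprime⟩ := MVIdeal.exists_prime _ hf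
  obtain ⟨W, _, _, _, _, _, u, ι, hinj, hzero, hnonneg, hadd, hcompl, hdelta⟩ :=
    DMVAlgebra.exists_embedding_ordered_module P.Quot (MVIdeal.quot_le_total hprime)
  let a : Fin n → W := fun i => ι (P.toQuot (FreeDMV.gen i))
  have hval : ∀ t : DMVTerm n, ι (P.toQuot (FreeDMV.mk t)) = t.value u a := by
    intro t
    induction t with
    | var i => rfl
    | zero => exact hzero
    | add s t hs ht =>
      rw [DMVTerm.value, ← hs, ← ht, ← hadd]
      rfl
    | compl t ht =>
      rw [DMVTerm.value, ← ht, ← hcompl]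
      rfl
    | delta k t ht =>
      rw [DMVTerm.value, ← ht, ← hdelta]
      rfl
  have hle : ∀ x, ι x ≤ u := fun x => by
    have := hnonneg xᶜ
    rwa [hcompl, sub_nonneg] at this
  have hg : g.value u a = 0 := by
    rw [← hval, (MVIdeal.toQuot_eq_zero_iff P _).2 (hP (MVIdeal.subset_span _ rfl)), hzero]
  have hf0 : 0 < f.value u a := by
    rw [← hval]
    refine lt_of_le_of_ne (hnonneg _) fun h0 => hfP ?_
    rw [← hzero] at h0
    exact (MVIdeal.toQuot_eq_zero_iff P _).1 (hinj h0).symm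
  have hu : 0 < u := hf0.trans_le (hval f ▸ hle _)
  obtain ⟨Qf, hQf⟩ := f.exists_pieces
  obtain ⟨Qg, hQg⟩ := g.exists_pieces
  obtain ⟨⟨p, hp, hp'⟩, hfa⟩ := hQf W u a
  obtain ⟨⟨q, hq, hq'⟩, hga⟩ := hQg W u a
  -- The forms transferred are the inequalities of the pieces active at `a`, the two affine values
  -- there, and the bounds `0 ≤ x i ≤ 1`.
  obtain ⟨x, hx⟩ := exists_real_same_sign hu a
    ({s | s ∈ p.1} ∪ {s | s ∈ q.1} ∪ {p.2, q.2} ∪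
      (Set.range (fun i => (0, Pi.single i 1)) ∪
        Set.range (fun i => (1, 0) - (0, Pi.single i 1)))) (by
      refine (((List.finite_toSet _).union (List.finite_toSet _)).union (Set.toFinite _)).union
        ((Set.finite_range _).union (Set.finite_range _)))
  have hfx := (hQf ℝ 1 x).2 p hp fun s hs =>
    (hx s (Or.inl (Or.inl (Or.inl hs)))).2.1 (hp' s hs)
  have hgx := (hQg ℝ 1 x).2 q hq fun s hs =>
    (hx s (Or.inl (Or.inl (Or.inr hs)))).2.1 (hq' s hs)
  have hfx0 : 0 < f.value 1 x := by
    rw [hfx, ← (hx p.2 (by simp)).1, ← hfa p hp hp']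
    exact hf0
  have hgx0 : g.value 1 x = 0 := by
    rw [hgx]
    obtain ⟨h1, h2⟩ := hx q.2 (by simp)
    rw [← hga q hq hq', hg] at h1 h2
    exact le_antisymm (not_lt.1 fun h => lt_irrefl _ (h1.2 h)) (h2.1 le_rfl)
  refine hfx0.ne' (h x (fun i => ⟨?_, ?_⟩) hgx0)
  · have := (hx (0, Pi.single i 1) (Or.inr (Or.inl ⟨i, rfl⟩))).2
    rw [affineEval_var, affineEval_var] at this
    exact this.1 (hnonneg _)
  · have := (hx ((1, 0) - (0, Pi.single i 1)) (Or.inr (Or.inr ⟨i, rfl⟩))).2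
    rw [map_sub, map_sub, affineEval_var, affineEval_var, affineEval_one, affineEval_one, sub_nonneg,
      sub_nonneg] at this
    exact this.1 (hle _)

/-! ### McNaughton's theorem -/

section PiecewiseLinear

open Filter Topology

/-- A continuous function on `[0, 1]` that agrees everywhere with one of finitely many affine
functions: one of them lies below at `0` and above at `1`. -/
theorem exists_affine_le_of_continuousOn {φ : ℝ → ℝ} (hφ : ContinuousOn φ (Set.Icc 0 1))
    {I : Set (ℝ × ℝ)} (hI : I.Finite)
    (h : ∀ s ∈ Set.Icc (0 : ℝ) 1, ∃ l ∈ I, φ s = l.1 + l.2 * s) :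
    ∃ l ∈ I, l.1 ≤ φ 0 ∧ φ 1 ≤ l.1 + l.2 := by
  -- Near `t` some piece recurs, as there are finitely many. By continuity it agrees with `φ` at `t`
  -- as well as at some point of `s`.
  have key : ∀ (t : ℝ) (s : Set ℝ), t ∈ Set.Icc (0 : ℝ) 1 → s ⊆ Set.Icc 0 1 → (𝓝[s] t).NeBot →
      ∃ l ∈ I, φ t = l.1 + l.2 * t ∧ ∃ r ∈ s, φ r = l.1 + l.2 * r := by
    intro t s ht hs hne
    obtain ⟨l, hl, hfreq⟩ : ∃ l ∈ I, ∃ᶠ r in 𝓝[s] t, φ r = l.1 + l.2 * r := by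
      by_contra! hcon
      have h1 : ∀ᶠ r in 𝓝[s] t, ∀ l ∈ I, φ r ≠ l.1 + l.2 * r :=
        (eventually_all_finite hI).2 fun l hl => hcon l hl
      obtain ⟨r, hr, hrs⟩ := (h1.and self_mem_nhdsWithin).exists
      obtain ⟨l, hl, hlr⟩ := h r (hs hrs)
      exact hr l hl hlr
    refine ⟨l, hl, ?_, ?_⟩
    · have hc : ContinuousOn (fun r => φ r - (l.1 + l.2 * r)) (Set.Icc 0 1) := by fun_prop
      have := isClosed_singleton.mem_of_frequently_of_tendsto
        (hfreq.mono fun r hr => show φ r - (l.1 + l.2 * r) ∈ ({0} : Set ℝ) from sub_eq_zero.2 hr)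
        ((hc t ht).mono hs)
      exact sub_eq_zero.1 this
    · obtain ⟨r, hr, hrs⟩ := (hfreq.and_eventually self_mem_nhdsWithin).exists
      exact ⟨r, hrs, hr⟩
  by_cases hneg : ∃ s ∈ Set.Ioo (0 : ℝ) 1, φ s < φ 0 + (φ 1 - φ 0) * s
  · obtain ⟨s, hs, hφs⟩ := hneg
    -- Below the chord at `s`, the function first returns to it at `t = inf Z`. A piece active at
    -- `t` and at some `r < t` is steeper than the chord and crosses it in between, so it lies below
    -- at `0` and above at `1`.
    let Z : Set ℝ := Set.Icc s 1 ∩ (fun r => φ r - (φ 0 + (φ 1 - φ 0) * r)) ⁻¹' Set.Ici 0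
    have hsub : Set.Icc s 1 ⊆ Set.Icc 0 1 := Set.Icc_subset_Icc_left hs.1.le
    have hZc : IsClosed Z := by
      refine ContinuousOn.preimage_isClosed_of_isClosed ?_ isClosed_Icc isClosed_Ici
      have := hφ.mono hsub
      fun_prop
    have hZb : BddBelow Z := ⟨s, fun r hr => hr.1.1⟩
    have hZne : Z.Nonempty := ⟨1, ⟨hs.2.le, le_rfl⟩, by simp⟩
    have htZ := hZc.csInf_mem hZne hZb
    set t := sInf Z
    have hst : s < t := by
      refine lt_of_le_of_ne htZ.1.1 ?_
      intro hst
      have := htZ.2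
      rw [← hst] at this
      exact absurd (show 0 ≤ φ s - (φ 0 + (φ 1 - φ 0) * s) from this) (by linarith)
    obtain ⟨l, hl, hlt, r, hr, hlr⟩ := key t (Set.Ioo s t) (hsub htZ.1)
      (fun r hr => ⟨hs.1.le.trans hr.1.le, hr.2.le.trans htZ.1.2⟩)
      (mem_closure_iff_nhdsWithin_neBot.1 (by
        rw [closure_Ioo hst.ne]; exact ⟨hst.le, le_rfl⟩))
    have h1 : φ 0 + (φ 1 - φ 0) * t ≤ φ t := sub_nonneg.1 htZ.2
    have h2 : φ r < φ 0 + (φ 1 - φ 0) * r := by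
      by_contra! hcon
      exact absurd (csInf_le hZb ⟨⟨hr.1.le, hr.2.le.trans htZ.1.2⟩, sub_nonneg.2 hcon⟩)
        (not_le.2 hr.2)
    have ht1 : t ≤ 1 := htZ.1.2
    have hr0 : 0 < r := hs.1.trans hr.1
    have hrt : r < t := hr.2
    rw [hlt] at h1
    rw [hlr] at h2
    have hslope : 0 < l.2 - (φ 1 - φ 0) := by
      by_contra! hcon
      nlinarith
    exact ⟨l, hl, by nlinarith, by nlinarith⟩
  · push Not at hneg
    -- If `φ` never dips below its chord, a piece starting at `φ 0` and active at some `r > 0` has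
    -- at least the slope of the chord.
    obtain ⟨l, hl, hl0, r, hr, hlr⟩ := key 0 (Set.Ioo 0 1) ⟨le_rfl, zero_le_one⟩
      Set.Ioo_subset_Icc_self (mem_closure_iff_nhdsWithin_neBot.1 (by
        rw [closure_Ioo zero_ne_one]; exact ⟨le_rfl, zero_le_one⟩))
    have h1 := hneg r hr
    rw [hlr] at h1
    rw [mul_zero, add_zero] at hl0
    refine ⟨l, hl, hl0.ge, ?_⟩
    have hr0 : 0 < r := hr.1
    rw [hl0] at h1
    have : 0 ≤ l.2 - (φ 1 - φ 0) := by
      by_contra! hcon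
      nlinarith
    linarith

/-- For two points `a` and `b` some affine piece lies below `f` at `a` and above `f` at `b`. -/
theorem exists_affineEval_le {n : ℕ} {f : (Fin n → unitInterval) → unitInterval}
    (hf : Continuous f) {L : Set (ℚ × (Fin n → ℚ))} (hL : L.Finite)
    (h : ∀ x, ∃ l ∈ L, (f x : ℝ) = affineEval (1 : ℝ) (fun i => (x i : ℝ)) l)
    (a b : Fin n → unitInterval) :
    ∃ l ∈ L, affineEval (1 : ℝ) (fun i => (a i : ℝ)) l ≤ f a ∧
      (f b : ℝ) ≤ affineEval (1 : ℝ) (fun i => (b i : ℝ)) l := by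
  -- The segment from `a` to `b`. The projection only supplies values in the cube for parameters
  -- outside `[0, 1]`.
  let γ : ℝ → Fin n → unitInterval := fun s i =>
    Set.projIcc 0 1 zero_le_one ((a i : ℝ) + (b i - a i) * s)
  have hγ : ∀ s ∈ Set.Icc (0 : ℝ) 1, ∀ i, (γ s i : ℝ) = a i + (b i - a i) * s := by
    intro s hs i
    have ha := (a i).2
    have hb := (b i).2
    have : (a i : ℝ) + (b i - a i) * s ∈ Set.Icc (0 : ℝ) 1 := by
      constructor
      · nlinarith [ha.1, hb.1, hs.1, hs.2, mul_nonneg hb.1 hs.1]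
      · nlinarith [ha.2, hb.2, hs.1, hs.2]
    simp only [γ, Set.projIcc_of_mem _ this]
  have hγ0 : γ 0 = a := funext fun i => Subtype.ext (by
    rw [hγ 0 ⟨le_rfl, zero_le_one⟩, mul_zero, add_zero])
  have hγ1 : γ 1 = b := funext fun i => Subtype.ext (by
    rw [hγ 1 ⟨zero_le_one, le_rfl⟩]; ring)
  let c : ℚ × (Fin n → ℚ) → ℝ × ℝ := fun l => (affineEval (1 : ℝ) (fun i => (a i : ℝ)) l,
    affineEval (1 : ℝ) (fun i => (b i : ℝ)) l - affineEval (1 : ℝ) (fun i => (a i : ℝ)) l)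
  have hcont : Continuous fun s => (f (γ s) : ℝ) := by
    have hγc : Continuous γ := continuous_pi fun i => continuous_projIcc.comp (by fun_prop)
    exact continuous_subtype_val.comp (hf.comp hγc)
  obtain ⟨_, ⟨l, hl, rfl⟩, h0, h1⟩ := exists_affine_le_of_continuousOn hcont.continuousOn
    (hL.image c) (by
      intro s hs
      obtain ⟨l, hl, hfl⟩ := h (γ s)
      refine ⟨_, ⟨l, hl, rfl⟩, hfl.trans ?_⟩
      simp only [c, affineEval_real, hγ s hs, mul_add, Finset.sum_add_distrib,
        add_sub_add_left_eq_sub, ← Finset.sum_sub_distrib, Finset.sum_mul, ← add_assoc]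
      congr 1
      exact Finset.sum_congr rfl fun i _ => by ring)
  rw [hγ0] at h0
  rw [hγ1, add_sub_cancel] at h1
  exact ⟨l, hl, h0, h1⟩

namespace DMVTerm

variable {n : ℕ}

theorem value_mem (t : DMVTerm n) {x : Fin n → ℝ} (hx : ∀ i, x i ∈ unitInterval) :
    t.value 1 x ∈ unitInterval := by
  induction t with
  | var i => exact hx i
  | zero => exact ⟨le_rfl, zero_le_one⟩
  | add s t hs ht => exact ⟨le_min (add_nonneg hs.1 ht.1) zero_le_one, min_le_right _ _⟩
  | compl t ht => exact ⟨sub_nonneg.2 ht.2, sub_le_self _ ht.1⟩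
  | delta k t ht =>
    have hk : (1 : ℝ) ≤ ((k : ℕ) : ℝ) := by exact_mod_cast k.pos
    rw [value, Rat.smul_def, Rat.cast_inv, Rat.cast_natCast]
    exact ⟨mul_nonneg (by positivity) ht.1, mul_le_one₀ (inv_le_one_of_one_le₀ hk) ht.1 ht.2⟩

theorem value_nmul (t : DMVTerm n) {x : Fin n → ℝ} (hx : ∀ i, x i ∈ unitInterval) (k : ℕ) :
    (nmul k t).value 1 x = min (k * t.value 1 x) 1 := by
  have h0 := (t.value_mem hx).1
  induction k with
  | zero => simp [nmul, value]
  | succ k ih =>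
    rw [nmul, value, ih]
    push_cast
    rw [add_mul, one_mul]
    rcases le_total ((k : ℝ) * t.value 1 x) 1 with h | h
    · rw [min_eq_left h]
    · rw [min_eq_right h, min_eq_right (by linarith), min_eq_right (by linarith)]

theorem exists_value_mul (t : DMVTerm n) {q : ℚ} (h0 : 0 ≤ q) (h1 : q ≤ 1) :
    ∃ s : DMVTerm n, ∀ x : Fin n → ℝ, (∀ i, x i ∈ unitInterval) → s.value 1 x = q * t.value 1 x := by
  refine ⟨nmul q.num.toNat (delta q.pnatDen t), fun x hx => ?_⟩
  have hq : ((q.num.toNat : ℕ) : ℝ) * ((q.den : ℝ))⁻¹ = q := by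
    have h2 : ((q.num.toNat : ℕ) : ℝ) = (q.num : ℝ) := by
      exact_mod_cast Int.toNat_of_nonneg (Rat.num_nonneg.2 h0)
    rw [h2, ← div_eq_mul_inv]
    exact (Rat.cast_def q).symm
  rw [value_nmul _ hx, value, Rat.smul_def, Rat.cast_inv, Rat.cast_natCast, Rat.coe_pnatDen, ← mul_assoc,
    hq]
  have ht := t.value_mem hx
  exact min_eq_left (mul_le_one₀ (by exact_mod_cast h1) ht.1 ht.2)

theorem exists_value_sum (c : ℚ) (b : Fin n → ℚ) (hc : 0 ≤ c) (hb : ∀ i, 0 ≤ b i)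
    (s : Finset (Fin n)) (h : c + ∑ i ∈ s, b i ≤ 1) :
    ∃ t : DMVTerm n, ∀ x : Fin n → ℝ, (∀ i, x i ∈ unitInterval) →
      t.value 1 x = c + ∑ i ∈ s, (b i : ℝ) * x i := by
  classical
  induction s using Finset.induction_on with
  | empty =>
    obtain ⟨t, ht⟩ := (compl zero : DMVTerm n).exists_value_mul hc (by simpa using h)
    exact ⟨t, fun x hx => by rw [ht x hx]; simp [value]⟩
  | insert i s hi ih =>
    rw [Finset.sum_insert hi] at h
    have hs : 0 ≤ ∑ j ∈ s, b j := Finset.sum_nonneg fun j _ => hb j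
    obtain ⟨t, ht⟩ := ih (by linarith [hb i])
    obtain ⟨r, hr⟩ := (var i : DMVTerm n).exists_value_mul (hb i) (by linarith)
    refine ⟨add t r, fun x hx => ?_⟩
    have e : (c : ℝ) + ∑ j ∈ insert i s, (b j : ℝ) * x j =
        c + ∑ j ∈ s, (b j : ℝ) * x j + b i * x i := by
      rw [Finset.sum_insert hi]
      ring
    rw [e, value, ht x hx, hr x hx, value, min_eq_left]
    rw [← e]
    refine le_trans ?_ (show (c : ℝ) + ∑ j ∈ insert i s, (b j : ℝ) ≤ 1 by
      rw [Finset.sum_insert hi]; exact_mod_cast h)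
    gcongr with j
    exact mul_le_of_le_one_right (by exact_mod_cast hb j) (hx j).2

/-- Truncated rational affine functions are term functions. -/
theorem exists_value_clip (l : ℚ × (Fin n → ℚ)) :
    ∃ t : DMVTerm n, ∀ x : Fin n → ℝ, (∀ i, x i ∈ unitInterval) →
      t.value 1 x = min (max (affineEval (1 : ℝ) x l) 0) 1 := by
  -- Division by `N` keeps the sums of the positive and of the negative coefficients at most `1`, so
  -- no sum truncates; the extra `1` makes `N` positive.
  obtain ⟨N, hN⟩ := exists_nat_ge (|l.1| + ∑ i, |l.2 i| + 1)
  have hsum : 0 ≤ ∑ i, |l.2 i| := Finset.sum_nonneg fun i _ => abs_nonneg _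
  have hN0 : (0 : ℚ) < N := by linarith [abs_nonneg l.1]
  have key : ∀ m : ℚ × (Fin n → ℚ), |m.1| = |l.1| → (∀ i, |m.2 i| = |l.2 i|) →
      ∃ t : DMVTerm n, ∀ x : Fin n → ℝ, (∀ i, x i ∈ unitInterval) →
        t.value 1 x = ((m.1⁺ / N : ℚ) : ℝ) + ∑ i, (((m.2 i)⁺ / N : ℚ) : ℝ) * x i := by
    intro m h1 h2
    refine exists_value_sum _ (fun i => (m.2 i)⁺ / N) (div_nonneg (posPart_nonneg _) hN0.le)
      (fun i => div_nonneg (posPart_nonneg _) hN0.le) _ ?_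
    rw [← Finset.sum_div, ← add_div, div_le_one hN0]
    have hp : ∀ q : ℚ, q⁺ ≤ |q| := fun q => sup_le (le_abs_self q) (abs_nonneg q)
    have h3 : ∑ i, (m.2 i)⁺ ≤ ∑ i, |l.2 i| :=
      Finset.sum_le_sum fun i _ => (hp _).trans (h2 i).le
    linarith [(hp m.1).trans h1.le]
  obtain ⟨p, hp⟩ := key l rfl fun _ => rfl
  obtain ⟨q, hq⟩ := key (-l) (abs_neg _) fun _ => abs_neg _
  -- Here `p - q` is the form divided by `N`. The term `(p* ⊕ q)*` is `max (p - q) 0`, and its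
  -- `N`-fold sum restores the scale and truncates at `1`.
  refine ⟨nmul N (compl (add (compl p) q)), fun x hx => ?_⟩
  have hN0' : (0 : ℝ) < N := by exact_mod_cast hN0
  have e : p.value 1 x - q.value 1 x = affineEval (1 : ℝ) x l / N := by
    have hpn : ∀ a : ℚ, ((a⁺ / N : ℚ) : ℝ) - (((-a)⁺ / N : ℚ) : ℝ) = a / N := by
      intro a
      have : a⁺ - (-a)⁺ = a := by rw [posPart_neg, posPart_sub_negPart]
      rw [← Rat.cast_sub, ← sub_div, this]
      push_cast
      rfl
    rw [hp x hx, hq x hx, affineEval_real, add_sub_add_comm, ← Finset.sum_sub_distrib, add_div,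
      Finset.sum_div]
    simp only [← sub_mul, Prod.fst_neg, Prod.snd_neg, Pi.neg_apply, hpn]
    congr 1
    exact Finset.sum_congr rfl fun i _ => by ring
  have e2 : (compl (add (compl p) q)).value 1 x = max (affineEval (1 : ℝ) x l / N) 0 := by
    rw [← e]
    simp only [value]
    grind
  rw [value_nmul _ hx, e2, mul_max_of_nonneg _ _ hN0'.le, mul_zero, mul_div_cancel₀ _ hN0'.ne']

/-- The join of two terms is `(s* ⊕ t)* ⊕ t`. The condition `0 ≤ c` accounts for the empty join. -/
theorem exists_value_sup (S : Set (DMVTerm n)) (hS : S.Finite) :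
    ∃ t : DMVTerm n, ∀ x : Fin n → ℝ, (∀ i, x i ∈ unitInterval) → (∀ s ∈ S, s.value 1 x ≤ t.value 1 x) ∧
      ∀ c, 0 ≤ c → (∀ s ∈ S, s.value 1 x ≤ c) → t.value 1 x ≤ c := by
  induction S, hS using Set.Finite.induction_on with
  | empty => exact ⟨zero, fun x _ => by simp [value]⟩
  | insert _ _ ih =>
    rename_i s S _ _
    obtain ⟨t, ht⟩ := ih
    refine ⟨add (compl (add (compl s) t)) t, fun x hx => ?_⟩
    obtain ⟨h1, h2⟩ := ht x hx
    have hs := s.value_mem hx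
    have htx := t.value_mem hx
    have e : (add (compl (add (compl s) t)) t).value 1 x = max (s.value 1 x) (t.value 1 x) := by
      obtain ⟨hs0, hs1⟩ := hs
      obtain ⟨ht0, ht1⟩ := htx
      simp only [value]
      grind
    rw [e]
    refine ⟨Set.forall_mem_insert.2 ⟨le_max_left _ _, fun r hr =>
      (h1 r hr).trans (le_max_right _ _)⟩, fun c hc h => ?_⟩
    rw [Set.forall_mem_insert] at h
    exact max_le h.1 (h2 c hc h.2)

theorem exists_value_inf (S : Set (DMVTerm n)) (hS : S.Finite) :
    ∃ t : DMVTerm n, ∀ x : Fin n → ℝ, (∀ i, x i ∈ unitInterval) → (∀ s ∈ S, t.value 1 x ≤ s.value 1 x) ∧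
      ∀ c, c ≤ 1 → (∀ s ∈ S, c ≤ s.value 1 x) → c ≤ t.value 1 x := by
  obtain ⟨t, ht⟩ := exists_value_sup (compl '' S) (hS.image _)
  refine ⟨compl t, fun x hx => ?_⟩
  obtain ⟨h1, h2⟩ := ht x hx
  simp only [Set.forall_mem_image, value] at h1 h2 ⊢
  refine ⟨fun s hs => by linarith [h1 hs], fun c hc h => ?_⟩
  have := h2 (1 - c) (by linarith) fun s hs => by linarith [h s hs]
  linarith

/-- McNaughton's theorem: rational piecewise linear functions are term functions. -/
theorem exists_value_eq {f : (Fin n → unitInterval) → unitInterval} (hf : IsRationalPL f) :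
    ∃ t : DMVTerm n, ∀ x, t.value 1 (fun i => (x i : ℝ)) = f x := by
  obtain ⟨hfc, L, hL, hfL⟩ := hf
  have hfL' : ∀ x, ∃ l ∈ L, (f x : ℝ) = affineEval (1 : ℝ) (fun i => (x i : ℝ)) l := by
    intro x
    obtain ⟨l, hl, h⟩ := hfL x
    exact ⟨l, hl, by rw [h, affineEval_real]⟩
  choose clip hclip using exists_value_clip (n := n)
  let J : (Fin n → unitInterval) → Set (ℚ × (Fin n → ℚ)) := fun y =>
    {l ∈ L | (f y : ℝ) ≤ affineEval (1 : ℝ) (fun i => (y i : ℝ)) l}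
  have hinf : ∀ K : Set (ℚ × (Fin n → ℚ)), K ⊆ L → ∃ t : DMVTerm n, ∀ x : Fin n → unitInterval,
      (∀ l ∈ K, t.value 1 (fun i => (x i : ℝ)) ≤ (clip l).value 1 (fun i => (x i : ℝ))) ∧
      ∀ c, c ≤ 1 → (∀ l ∈ K, c ≤ (clip l).value 1 (fun i => (x i : ℝ))) →
        c ≤ t.value 1 (fun i => (x i : ℝ)) := by
    intro K hK
    obtain ⟨t, ht⟩ := exists_value_inf (clip '' K) ((hL.subset hK).image _)
    refine ⟨t, fun x => ?_⟩
    have := ht _ fun i => (x i).2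
    simpa only [Set.forall_mem_image] using this
  have : Nonempty (DMVTerm n) := ⟨zero⟩
  choose! inf hinf using hinf
  -- Max-min representation: the join over `y` of the meets of the clipped pieces lying above `f` at
  -- `y`. There are finitely many sets `J y`, being subsets of `L`.
  obtain ⟨t, ht⟩ := exists_value_sup (inf '' Set.range J)
    (((hL.finite_subsets).subset (by rintro _ ⟨y, rfl⟩; exact Set.sep_subset _ _)).image _)
  refine ⟨t, fun x => ?_⟩
  obtain ⟨h1, h2⟩ := ht _ fun i => (x i).2
  simp only [Set.forall_mem_image, Set.forall_mem_range] at h1 h2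
  -- For the upper bound at `x`, each `J y` contains a piece that is at most `f` at `x`. For the
  -- lower bound, the meet over `J x` is already at least `f x`.
  refine le_antisymm (h2 _ (f x).2.1 fun y => ?_) (le_trans ?_ (h1 x))
  · obtain ⟨l, hl, hlx, hly⟩ := exists_affineEval_le hfc hL hfL' x y
    refine ((hinf (J y) (Set.sep_subset _ _) x).1 l ⟨hl, hly⟩).trans ?_
    rw [hclip l _ fun i => (x i).2]
    exact (min_le_left _ _).trans (max_le hlx (f x).2.1)
  · refine (hinf (J x) (Set.sep_subset _ _) x).2 _ (f x).2.2 fun l hl => ?_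
    rw [hclip l _ fun i => (x i).2]
    exact le_min (hl.2.trans (le_max_left _ _)) (f x).2.2

end DMVTerm

end PiecewiseLinear

/-! ### Rational polytopes and zero sets -/

section Convex

open Pointwise

variable {E : Type*} [AddCommGroup E] [Module ℝ E]

/-- The convex hull of a finite set intersected with a half-space is the convex hull of the vertices
in the half-space and of the points where segments between vertices cross its boundary. -/
theorem convexHull_inter_halfspace (g : E → ℝ)
    (hg : ∀ (x y : E) (a b : ℝ), a + b = 1 → g (a • x + b • y) = a * g x + b * g y) (V : Set E) :
    convexHull ℝ V ∩ {x | 0 ≤ g x} = convexHull ℝ ({v ∈ V | 0 ≤ g v} ∪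
      Set.image2 (fun v w => (g v - g w)⁻¹ • (g v • w - g w • v))
        {v ∈ V | 0 ≤ g v} {w ∈ V | g w < 0}) := by
  set Vp : Set E := {v ∈ V | 0 ≤ g v}
  set Vn : Set E := {w ∈ V | g w < 0}
  set cross : E → E → E := fun v w => (g v - g w)⁻¹ • (g v • w - g w • v)
  set K := convexHull ℝ (Vp ∪ Set.image2 cross Vp Vn)
  have hK : Convex ℝ K := convex_convexHull ℝ _
  have hVK : ∀ v ∈ Vp, v ∈ K := fun v hv => subset_convexHull ℝ _ (Or.inl hv)
  have hconv : ∀ s : Set ℝ, Convex ℝ s → Convex ℝ (g ⁻¹' s) := by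
    intro s hs x hx y hy a b ha hb hab
    rw [Set.mem_preimage, hg _ _ _ _ hab]
    exact hs hx hy ha hb hab
  have hVpg : ∀ p ∈ convexHull ℝ Vp, 0 ≤ g p := fun p hp =>
    convexHull_min (fun v hv => hv.2) (hconv _ (convex_Ici 0)) hp
  have hVng : ∀ q ∈ convexHull ℝ Vn, g q < 0 := fun q hq =>
    convexHull_min (fun v hv => hv.2) (hconv _ (convex_Iio 0)) hq
  refine Set.Subset.antisymm ?_ ?_
  · rintro x ⟨hx, hgx⟩
    have hV : V = Vp ∪ Vn := by
      ext v
      constructor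
      · intro hv
        exact (le_or_gt 0 (g v)).imp (fun h => ⟨hv, h⟩) fun h => ⟨hv, h⟩
      · rintro (h | h) <;> exact h.1
    have hpK : convexHull ℝ Vp ⊆ K := convexHull_mono Set.subset_union_left
    rcases Vn.eq_empty_or_nonempty with hn | hn
    · rw [hV, hn, Set.union_empty] at hx
      exact hpK hx
    rcases Vp.eq_empty_or_nonempty with hp | hp
    · rw [hV, hp, Set.empty_union] at hx
      exact absurd hgx (not_le.2 (hVng x hx))
    rw [hV, convexHull_union hp hn, mem_convexJoin] at hx
    obtain ⟨p, hp, q, hq, a, b, ha, hb, hab, rfl⟩ := hx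
    -- The crossing point of a segment `pq`, cleared of its denominator, is affine in `p` and in `q`
    -- separately. Since `aK + bK = (a + b)K` for convex `K`, membership extends from vertices to
    -- the hull in `p`, then in `q`.
    have base : ∀ v ∈ Vp, ∀ w ∈ Vn, g v • w - g w • v ∈ (g v - g w) • K := by
      intro v hv w hw
      refine ⟨cross v w, subset_convexHull ℝ _ (Or.inr ⟨v, hv, w, hw, rfl⟩), ?_⟩
      have : g v - g w ≠ 0 := by linarith [hv.2, hw.2]
      exact smul_inv_smul₀ this _
    have step1 : ∀ w ∈ Vn, ∀ p ∈ convexHull ℝ Vp, g p • w - g w • p ∈ (g p - g w) • K := by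
      intro w hw p hp
      have hsub : Vp ⊆ {p | 0 ≤ g p ∧ g p • w - g w • p ∈ (g p - g w) • K} :=
        fun v hv => ⟨hv.2, base v hv w hw⟩
      refine (convexHull_min hsub ?_ hp).2
      rintro x ⟨hx0, hx⟩ y ⟨hy0, hy⟩ a b ha hb hab
      refine ⟨by rw [hg _ _ _ _ hab]; positivity, ?_⟩
      have e1 : g (a • x + b • y) • w - g w • (a • x + b • y) =
          a • (g x • w - g w • x) + b • (g y • w - g w • y) := by
        rw [hg _ _ _ _ hab]
        module
      have e2 : g (a • x + b • y) - g w = a * (g x - g w) + b * (g y - g w) := by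
        rw [hg _ _ _ _ hab]
        linear_combination (-g w) * hab.symm
      have hw0 := hw.2
      rw [e1, e2, hK.add_smul (mul_nonneg ha (by linarith)) (mul_nonneg hb (by linarith)), mul_smul,
        mul_smul]
      exact Set.add_mem_add (Set.smul_mem_smul_set hx) (Set.smul_mem_smul_set hy)
    have step2 : ∀ p ∈ convexHull ℝ Vp, ∀ q ∈ convexHull ℝ Vn,
        g p • q - g q • p ∈ (g p - g q) • K := by
      intro p hp q hq
      have hsub : Vn ⊆ {q | g q < 0 ∧ g p • q - g q • p ∈ (g p - g q) • K} :=
        fun w hw => ⟨hw.2, step1 w hw p hp⟩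
      refine (convexHull_min hsub ?_ hq).2
      rintro x ⟨hx0, hx⟩ y ⟨hy0, hy⟩ a b ha hb hab
      refine ⟨hconv _ (convex_Iio 0) hx0 hy0 ha hb hab, ?_⟩
      have e1 : g p • (a • x + b • y) - g (a • x + b • y) • p =
          a • (g p • x - g x • p) + b • (g p • y - g y • p) := by
        rw [hg _ _ _ _ hab]
        module
      have e2 : g p - g (a • x + b • y) = a * (g p - g x) + b * (g p - g y) := by
        rw [hg _ _ _ _ hab]
        linear_combination (g p) * hab.symm
      have hp0 := hVpg p hp
      rw [e1, e2, hK.add_smul (mul_nonneg ha (by linarith)) (mul_nonneg hb (by linarith)), mul_smul,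
        mul_smul]
      exact Set.add_mem_add (Set.smul_mem_smul_set hx) (Set.smul_mem_smul_set hy)
    have hp0 := hVpg p hp
    have hq0 := hVng q hq
    rw [Set.mem_ofPred_eq, hg _ _ _ _ hab] at hgx
    obtain ⟨k, hk, hke⟩ := step2 p hp q hq
    change (g p - g q) • k = _ at hke
    -- If `g p = 0`, then `0 ≤ g x` forces `x = p`. Otherwise `x` lies between `p` and the crossing
    -- point `k`; the weight `t` is found by comparing coefficients of `q`.
    rcases hp0.eq_or_lt with h0 | h0
    · have hb0 : b = 0 := by
        rw [← h0] at hgx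
        nlinarith
      have ha1 : a = 1 := by linarith
      rw [hb0, ha1, one_smul, zero_smul, add_zero]
      exact hpK hp
    · have hD : 0 < g p - g q := by linarith
      set t := b * (g p - g q) / g p
      have ht0 : 0 ≤ t := div_nonneg (mul_nonneg hb hD.le) h0.le
      have ht1 : t ≤ 1 := by
        rw [div_le_one h0]
        nlinarith
      have hk' : k = (g p / (g p - g q)) • q - (g q / (g p - g q)) • p := by
        rw [← inv_smul_smul₀ hD.ne' k, hke, smul_sub, smul_smul, smul_smul, inv_mul_eq_div,
          inv_mul_eq_div]
      have hx : a • p + b • q = (1 - t) • p + t • k := by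
        have e1 : t * (g p / (g p - g q)) = b := by
          simp only [t]
          field_simp
        have e2 : (1 - t) - t * (g q / (g p - g q)) = a := by
          have h3 : g q / (g p - g q) = g p / (g p - g q) - 1 := by
            field_simp
            ring
          rw [h3]
          linear_combination -e1 - hab
        rw [hk', smul_sub, smul_smul, smul_smul, e1]
        rw [← e2]
        module
      rw [hx]
      exact hK (hpK hp) hk (by linarith) ht0 (by ring)
  · refine convexHull_min ?_ ((convex_convexHull ℝ V).inter (hconv _ (convex_Ici 0)))
    rintro x (hx | ⟨v, hv, w, hw, rfl⟩)
    · exact ⟨subset_convexHull ℝ _ hx.1, hx.2⟩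
    · have hv0 := hv.2
      have hw0 := hw.2
      have hD : 0 < g v - g w := by linarith
      have e : cross v w = (-g w / (g v - g w)) • v + (g v / (g v - g w)) • w := by
        simp only [cross, smul_sub, smul_smul, inv_mul_eq_div, neg_div, neg_smul]
        abel
      have h1 : -g w / (g v - g w) + g v / (g v - g w) = 1 := by
        field_simp
        ring
      change cross v w ∈ _
      rw [e]
      refine ⟨convex_convexHull ℝ V (subset_convexHull ℝ _ hv.1) (subset_convexHull ℝ _ hw.1)
        (div_nonneg (by linarith) hD.le) (div_nonneg hv0 hD.le) h1, ?_⟩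
      rw [Set.mem_ofPred_eq, hg _ _ _ _ h1]
      refine le_of_eq ?_
      field_simp
      ring

end Convex

section Polyhedra

variable {n : ℕ}

/-- Bounded solution sets of rational linear inequalities are rational polytopes. -/
theorem exists_convexHull_eq_polytope (T : List (ℚ × (Fin n → ℚ))) :
    ∃ V : Set (Fin n → ℝ), V.Finite ∧ (∀ v ∈ V, ∀ i, ∃ q : ℚ, v i = q) ∧
      convexHull ℝ V =
        {x | (∀ i, x i ∈ unitInterval) ∧ ∀ s ∈ T, 0 ≤ affineEval (1 : ℝ) x s} := by
  induction T with
  | nil =>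
    refine ⟨Set.univ.pi fun _ => {0, 1}, Set.Finite.pi fun _ => Set.toFinite _, ?_, ?_⟩
    · intro v hv i
      rcases hv i (Set.mem_univ i) with h | h
      · exact ⟨0, by rw [h]; simp⟩
      · exact ⟨1, by rw [h]; simp⟩
    · rw [convexHull_pi]
      ext x
      simp [convexHull_pair, segment_eq_Icc, unitInterval, Pi.le_def, forall_and]
  | cons l T ih =>
    obtain ⟨V, hV, hVq, hVT⟩ := ih
    let g : (Fin n → ℝ) → ℝ := fun x => affineEval (1 : ℝ) x l
    have hg : ∀ (x y : Fin n → ℝ) (a b : ℝ), a + b = 1 →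
        g (a • x + b • y) = a * g x + b * g y := by
      intro x y a b hab
      simp only [g, affineEval_real, Pi.add_apply, Pi.smul_apply, smul_eq_mul, mul_add,
        Finset.mul_sum, Finset.sum_add_distrib]
      have e1 : ∑ i, (l.2 i : ℝ) * (a * x i) = ∑ i, a * ((l.2 i : ℝ) * x i) :=
        Finset.sum_congr rfl fun i _ => by ring
      have e2 : ∑ i, (l.2 i : ℝ) * (b * y i) = ∑ i, b * ((l.2 i : ℝ) * y i) :=
        Finset.sum_congr rfl fun i _ => by ring
      rw [e1, e2]
      linear_combination (-(l.1 : ℝ)) * hab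
    have hgq : ∀ v ∈ V, ∃ q : ℚ, g v = q := by
      intro v hv
      choose q hq using hVq v hv
      refine ⟨l.1 + ∑ i, l.2 i * q i, ?_⟩
      simp only [g, affineEval_real, hq]
      push_cast
      rfl
    refine ⟨_, ((hV.subset (Set.sep_subset _ _)).union ((hV.subset (Set.sep_subset _ _)).image2 _
      (hV.subset (Set.sep_subset _ _)))), ?_, (convexHull_inter_halfspace g hg V).symm.trans ?_⟩
    · rintro v (hv | ⟨v, hv, w, hw, rfl⟩) i
      · exact hVq v hv.1 i
      · obtain ⟨p, hp⟩ := hVq v hv.1 i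
        obtain ⟨q, hq⟩ := hVq w hw.1 i
        obtain ⟨c, hc⟩ := hgq v hv.1
        obtain ⟨d, hd⟩ := hgq w hw.1
        refine ⟨(c - d)⁻¹ * (c * q - d * p), ?_⟩
        simp only [Pi.smul_apply, Pi.sub_apply, smul_eq_mul, hp, hq, hc, hd]
        push_cast
        rfl
    · rw [hVT]
      ext x
      simp only [Set.mem_inter_iff, Set.mem_ofPred_eq, List.forall_mem_cons, g]
      tauto

/-- By Carathéodory's theorem the hull is the union of the hulls of the affinely independent subsets
of `V`. The empty subset is discarded because a simplex has at least one vertex. -/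
theorem IsRationalPolyhedron.of_convexHull {V : Set (Fin n → ℝ)} (hV : V.Finite)
    (hVq : ∀ v ∈ V, ∀ i, v i ∈ unitInterval ∧ ∃ q : ℚ, v i = q) :
    IsRationalPolyhedron {x : Fin n → unitInterval | (fun i => (x i : ℝ)) ∈ convexHull ℝ V} := by
  let F : Finset (Fin n → ℝ) → Set (Fin n → unitInterval) := fun t =>
    {x | (fun i => (x i : ℝ)) ∈ convexHull ℝ (t : Set (Fin n → ℝ))}
  let I : Set (Finset (Fin n → ℝ)) := {t | (t : Set (Fin n → ℝ)) ⊆ V ∧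
    AffineIndependent ℝ ((↑) : t → Fin n → ℝ) ∧ t.Nonempty}
  have hI : I.Finite := by
    refine Set.Finite.subset (hV.finite_subsets.preimage Finset.coe_injective.injOn) ?_
    exact fun t ht => ht.1
  refine ⟨F '' I, hI.image _, ?_, ?_⟩
  · rintro _ ⟨t, ⟨htV, hti, htne⟩, rfl⟩
    obtain ⟨m, hm⟩ : ∃ m, t.card = m + 1 := ⟨t.card - 1, by have := htne.card_pos; omega⟩
    let e : Fin (m + 1) ≃ t := (finCongr hm.symm).trans t.equivFin.symm
    refine ⟨m, fun i => (e i : Fin n → ℝ), hti.comp_embedding e.toEmbedding,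
      fun i => hVq _ (htV (e i).2), ?_⟩
    have : Set.range (fun i => (e i : Fin n → ℝ)) = t := by
      change Set.range (Subtype.val ∘ e) = _
      rw [Set.range_comp, e.range_eq_univ, Set.image_univ, Subtype.range_coe_subtype]
      rfl
    rw [this]
  · ext x
    rw [Set.mem_ofPred_eq, convexHull_eq_union]
    simp only [Set.mem_iUnion, Set.mem_sUnion, Set.exists_mem_image]
    constructor
    · rintro ⟨t, ht, hti, hx⟩
      refine ⟨t, ⟨ht, hti, ?_⟩, hx⟩
      rw [← Finset.coe_nonempty, ← convexHull_nonempty_iff (𝕜 := ℝ)]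
      exact ⟨_, hx⟩
    · rintro ⟨t, ⟨ht, hti, -⟩, hx⟩
      exact ⟨t, ht, hti, hx⟩

theorem IsRationalPolyhedron.biUnion {ι : Type*} {I : Set ι} (hI : I.Finite)
    {P : ι → Set (Fin n → unitInterval)} (h : ∀ i ∈ I, IsRationalPolyhedron (P i)) :
    IsRationalPolyhedron (⋃ i ∈ I, P i) := by
  choose! T hT hTs hTP using h
  refine ⟨⋃ i ∈ I, T i, hI.biUnion hT, ?_, ?_⟩
  · intro S hS
    obtain ⟨i, hi, hS⟩ := Set.mem_iUnion₂.1 hS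
    exact hTs i hi S hS
  · rw [Set.sUnion_iUnion]
    refine Set.iUnion_congr fun i => ?_
    rw [Set.sUnion_iUnion]
    exact Set.iUnion_congr fun hi => hTP i hi

/-- Zero sets of term functions are rational polyhedra. -/
theorem DMVTerm.isRationalPolyhedron_zeros (t : DMVTerm n) :
    IsRationalPolyhedron {x : Fin n → unitInterval | t.value 1 (fun i => (x i : ℝ)) = 0} := by
  obtain ⟨Q, hQ⟩ := t.exists_pieces
  have hQ' := fun x : Fin n → ℝ => hQ ℝ 1 x
  -- On each piece the equation is a pair of opposite inequalities for its affine form.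
  have e : {x : Fin n → unitInterval | t.value 1 (fun i => (x i : ℝ)) = 0} =
      ⋃ p ∈ {p | p ∈ Q}, {x | ∀ s ∈ p.2 :: (-p.2) :: p.1,
        0 ≤ affineEval (1 : ℝ) (fun i => (x i : ℝ)) s} := by
    ext x
    obtain ⟨⟨p, hp, hp'⟩, h⟩ := hQ' fun i => (x i : ℝ)
    simp only [Set.mem_ofPred_eq, Set.mem_iUnion, List.forall_mem_cons, map_neg, exists_prop]
    constructor
    · intro hx
      rw [h p hp hp'] at hx
      exact ⟨p, hp, hx.ge, by rw [hx, neg_zero], hp'⟩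
    · rintro ⟨q, hq, h1, h2, h3⟩
      rw [h q hq h3]
      linarith
  rw [e]
  refine IsRationalPolyhedron.biUnion (List.finite_toSet Q) fun p _ => ?_
  obtain ⟨V, hV, hVq, hVT⟩ := exists_convexHull_eq_polytope (p.2 :: (-p.2) :: p.1)
  have hmem : ∀ v ∈ V, ∀ i, v i ∈ unitInterval := fun v hv =>
    (hVT ▸ subset_convexHull ℝ V hv : v ∈ {x : Fin n → ℝ | _}).1
  convert IsRationalPolyhedron.of_convexHull hV fun v hv i => ⟨hmem v hv i, hVq v hv i⟩ using 1
  rw [hVT]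
  ext x
  exact ⟨fun h => ⟨fun i => (x i).2, h⟩, fun h => h.2⟩

end Polyhedra

/-! ### Homomorphisms out of the free algebra -/

namespace DMVTerm

variable {n : ℕ} {A : Type*} [DMVAlgebra A]

/-- The value of a term in a DMV-algebra. -/
def eval (a : Fin n → A) : DMVTerm n → A
  | var i => a i
  | zero => 0
  | add s t => eval a s + eval a t
  | compl t => (eval a t)ᶜ
  | delta k t => DMVAlgebra.delta k (eval a t)

theorem eval_nmul (a : Fin n → A) (k : ℕ) (t : DMVTerm n) :
    eval a (nmul k t) = k • eval a t := by
  induction k with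
  | zero => exact (zero_nsmul _).symm
  | succ k ih => rw [nmul, eval, ih, succ_nsmul]

theorem Rel.eval_eq {s t : DMVTerm n} (h : Rel s t) (a : Fin n → A) : eval a s = eval a t := by
  induction h with
  | refl t => rfl
  | symm _ ih => exact ih.symm
  | trans _ _ ih ih' => exact ih.trans ih'
  | add_congr _ _ ih ih' => rw [eval, eval, ih, ih']
  | compl_congr _ ih => rw [eval, eval, ih]
  | delta_congr k _ ih => rw [eval, eval, ih]
  | add_assoc s t u => exact _root_.add_assoc _ _ _
  | add_comm s t => exact _root_.add_comm _ _
  | add_zero t => exact _root_.add_zero _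
  | compl_compl t => exact MVAlgebra.compl_invol _
  | luk s t => exact MVAlgebra.luk _ _
  | compl_zero_add t => exact MVAlgebra.compl_zero_add _
  | nmul_delta k t => rw [eval_nmul]; exact DMVAlgebra.nsmul_delta k _
  | delta_odot k t =>
    have := DMVAlgebra.delta_odot k (eval a t)
    simp only [odot, eval, eval_nmul]
    exact this

end DMVTerm

/-- The homomorphism from the free DMV-algebra determined by the images of the generators. -/
def FreeDMV.lift {n : ℕ} {A : Type*} [DMVAlgebra A] (a : Fin n → A) : FreeDMV n → A :=
  Quotient.lift (DMVTerm.eval a) fun _ _ h => DMVTerm.Rel.eval_eq h a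

/-! ### Maximal ideals from points, and kernels of restriction maps -/

section Points

variable {A : Type*} [MVAlgebra A]

/-- The zero set of a homomorphism to the real unit interval. -/
def MVIdeal.ofPoint (h : A → ℝ) (h0 : h 0 = 0) (hnonneg : ∀ x, 0 ≤ h x)
    (hadd : ∀ x y, h (x + y) = min (h x + h y) 1) (hcompl : ∀ x, h xᶜ = 1 - h x) : MVIdeal A where
  carrier := {x | h x = 0}
  zero_mem' := h0
  add_mem' := by
    intro x y hx hy
    rw [Set.mem_ofPred_eq] at *
    rw [hadd, hx, hy, add_zero, min_eq_left zero_le_one]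
  mem_of_le := by
    intro x y hxy hy
    change h y = 0 at hy
    have h1 := congrArg h ((MVAlgebra.le_iff x y).1 hxy)
    rw [hadd, hy, hcompl, hcompl, h0, add_zero, sub_zero] at h1
    have := min_le_left (1 - h x) 1
    exact le_antisymm (by linarith) (hnonneg x)

theorem MVIdeal.ofPoint_isMaximal (h : A → ℝ) (h0 : h 0 = 0) (hnonneg : ∀ x, 0 ≤ h x)
    (hadd : ∀ x y, h (x + y) = min (h x + h y) 1) (hcompl : ∀ x, h xᶜ = 1 - h x) :
    (MVIdeal.ofPoint h h0 hnonneg hadd hcompl).IsMaximal := by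
  have hnsmul : ∀ (x : A) (k : ℕ), h (k • x) = min (k * h x) 1 := by
    intro x k
    have hx := hnonneg x
    induction k with
    | zero => rw [zero_nsmul, h0]; simp
    | succ k ih =>
      rw [succ_nsmul, hadd, ih]
      push_cast
      rw [add_mul, one_mul]
      rcases le_total ((k : ℝ) * h x) 1 with hk | hk
      · rw [min_eq_left hk]
      · rw [min_eq_right hk, min_eq_right (by linarith), min_eq_right (by linarith)]
  constructor
  · intro htop
    have h1 : h (0 : A)ᶜ = 0 := htop.ge (Set.mem_univ _)
    rw [hcompl, h0] at h1
    norm_num at h1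
  · intro I hMI hI
    refine Set.Subset.antisymm (fun x hx => ?_) hMI
    by_contra hx0
    have hpos : 0 < h x := lt_of_le_of_ne (hnonneg x) (Ne.symm hx0)
    -- Archimedean property: some multiple `k • x` has value `1`, so its complement lies in the
    -- kernel, and the sum of the two is the top element.
    obtain ⟨k, hk⟩ := exists_nat_ge (1 / h x)
    rw [div_le_iff₀ hpos] at hk
    have h1 : (k • x)ᶜ ∈ I := hMI (show h (k • x)ᶜ = 0 by
      rw [hcompl, hnsmul, min_eq_right hk, sub_self])
    have h2 := I.add_mem h1 (I.nsmul_mem hx k)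
    rw [MVAlgebra.compl_add_self] at h2
    exact hI (Set.eq_univ_of_forall (I.mem_of_one_mem h2))

end Points

/-- An ideal that is the kernel of a surjective homomorphism has the image as quotient. -/
theorem MVIdeal.nonempty_iso_quot {A B : Type*} [DMVAlgebra A] [DMVAlgebra B] (J : MVIdeal A)
    (φ : A → B) (hsurj : Function.Surjective φ) (hadd : ∀ x y, φ (x + y) = φ x + φ y)
    (hcompl : ∀ x, φ xᶜ = (φ x)ᶜ)
    (hdelta : ∀ k x, φ (DMVAlgebra.delta k x) = DMVAlgebra.delta k (φ x))
    (hker : ∀ x, x ∈ J ↔ φ x = 0) : Nonempty (DMVIso J.Quot B) := by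
  have hodot : ∀ x y, φ (MVAlgebra.odot x yᶜ) = MVAlgebra.odot (φ x) (φ y)ᶜ := by
    intro x y
    simp only [MVAlgebra.odot, hcompl, hadd]
  have hrel : ∀ x y, J.setoid.r x y ↔ φ x = φ y := by
    intro x y
    change MVAlgebra.odot x yᶜ ∈ J ∧ MVAlgebra.odot y xᶜ ∈ J ↔ _
    rw [hker, hker, hodot, hodot]
    exact ⟨fun h => le_antisymm h.1 h.2, fun h => ⟨h.le, h.ge⟩⟩
  let ψ : J.Quot → B := Quotient.lift φ fun x y h => (hrel x y).1 h
  have hψ : Function.Bijective ψ := by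
    constructor
    · rintro ⟨x⟩ ⟨y⟩ h
      exact Quotient.sound (s := J.setoid) ((hrel x y).2 h)
    · intro y
      obtain ⟨x, rfl⟩ := hsurj y
      exact ⟨J.toQuot x, rfl⟩
  refine ⟨{ Equiv.ofBijective ψ hψ with map_add' := ?_, map_compl := ?_, map_delta := ?_ }⟩
  · rintro ⟨x⟩ ⟨y⟩
    exact hadd x y
  · rintro ⟨x⟩
    exact hcompl x
  · rintro k ⟨x⟩
    exact hdelta k x

namespace PLRestrict

variable {n : ℕ} (P : Set (Fin n → unitInterval))

/-- The coordinate functions. -/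
def coord (i : Fin n) : PLRestrict P :=
  ⟨fun x => x.1 i, fun x => x i, ⟨continuous_apply i, {(0, Pi.single i 1)}, Set.finite_singleton _,
    fun x => ⟨_, rfl, by
      rw [← affineEval_real (fun j => (x j : ℝ)), affineEval_var (1 : ℝ) (fun j => (x j : ℝ))]⟩⟩,
    fun _ => rfl⟩

theorem eval_coord_apply (t : DMVTerm n) (x : P) :
    ((t.eval (coord P)).1 x : ℝ) = t.value 1 (fun i => (x.1 i : ℝ)) := by
  induction t with
  | var i => rfl
  | zero => rfl
  | add s t hs ht => rw [DMVTerm.value, ← hs, ← ht]; rfl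
  | compl t ht => rw [DMVTerm.value, ← ht]; rfl
  | delta k t ht =>
    rw [DMVTerm.value, ← ht, Rat.smul_def, Rat.cast_inv, Rat.cast_natCast, inv_mul_eq_div]
    rfl

theorem lift_coord_surjective : Function.Surjective (FreeDMV.lift (coord P)) := by
  rintro ⟨f, f', hf', hff'⟩
  obtain ⟨t, ht⟩ := DMVTerm.exists_value_eq hf'
  refine ⟨FreeDMV.mk t, ext' fun x => ?_⟩
  change ((t.eval (coord P)).1 x : ℝ) = f x
  rw [eval_coord_apply, ht, hff']

variable {P}

theorem eq_zero_iff (f : PLRestrict P) : f = 0 ↔ ∀ x, (f.1 x : ℝ) = 0 :=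
  ⟨fun h x => by rw [h]; rfl, fun h => ext' h⟩

/-- The kernel of a homomorphism to `PLRestrict P` is an intersection of maximal ideals. -/
theorem exists_maximal_family {A : Type*} [MVAlgebra A] (φ : A → PLRestrict P) (h0 : φ 0 = 0)
    (hadd : ∀ x y, φ (x + y) = φ x + φ y) (hcompl : ∀ x, φ xᶜ = (φ x)ᶜ) :
    ∃ F : Set (MVIdeal A), (∀ M ∈ F, M.IsMaximal) ∧ ∀ a, φ a = 0 ↔ ∀ M ∈ F, a ∈ M := by
  let M : P → MVIdeal A := fun x => MVIdeal.ofPoint (fun a => ((φ a).1 x : ℝ)) (by rw [h0]; rfl)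
    (fun a => ((φ a).1 x).2.1) (fun a b => by rw [hadd]; rfl) fun a => by rw [hcompl]; rfl
  refine ⟨Set.range M, ?_, fun a => ?_⟩
  · rintro _ ⟨x, rfl⟩
    exact MVIdeal.ofPoint_isMaximal _ _ _ _ _
  · rw [Set.forall_mem_range, eq_zero_iff]
    rfl

end PLRestrict

/-! ### Principal ideals of the free algebra and the main theorem -/

namespace FreeDMV

variable {n : ℕ}

/-- The zero set of a term function in the unit cube. -/
def zeros (g : DMVTerm n) : Set (Fin n → unitInterval) :=
  {x | g.value 1 (fun i => (x i : ℝ)) = 0}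

theorem lift_coord_eq_zero_iff (P : Set (Fin n → unitInterval)) (f : DMVTerm n) :
    lift (PLRestrict.coord P) (mk f) = 0 ↔ ∀ x ∈ P, f.value 1 (fun i => (x i : ℝ)) = 0 := by
  change f.eval (PLRestrict.coord P) = 0 ↔ _
  rw [PLRestrict.eq_zero_iff]
  simp only [PLRestrict.eval_coord_apply, Subtype.forall]

variable {A : Type*} [DMVAlgebra A] (a : Fin n → A)

theorem lift_add (x y : FreeDMV n) : lift a (x + y) = lift a x + lift a y := by
  obtain ⟨x⟩ := x
  obtain ⟨y⟩ := y
  rfl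

theorem lift_compl (x : FreeDMV n) : lift a xᶜ = (lift a x)ᶜ := by
  obtain ⟨x⟩ := x
  rfl

theorem lift_delta (k : ℕ+) (x : FreeDMV n) :
    lift a (DMVAlgebra.delta k x) = DMVAlgebra.delta k (lift a x) := by
  obtain ⟨x⟩ := x
  rfl

/-- One direction is completeness. The other holds because the kernel is an intersection of ideals
that contain `g`. -/
theorem mem_span_iff_lift_eq_zero (g : DMVTerm n) (f : FreeDMV n) :
    f ∈ MVIdeal.span {mk g} ↔ lift (PLRestrict.coord (zeros g)) f = 0 := by
  obtain ⟨f, rfl⟩ : ∃ t, mk t = f := Quotient.exists_rep f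
  constructor
  · intro h
    obtain ⟨F, -, hF⟩ := PLRestrict.exists_maximal_family (lift (PLRestrict.coord (zeros g))) rfl
      (lift_add _) (lift_compl _)
    have hg : lift (PLRestrict.coord (zeros g)) (mk g) = 0 :=
      (lift_coord_eq_zero_iff _ g).2 fun x hx => hx
    exact (hF _).2 fun M hM => h M (Set.singleton_subset_iff.2 ((hF _).1 hg M hM))
  · intro h
    refine mem_span_of_zeros f g fun x hx hgx => ?_
    exact (lift_coord_eq_zero_iff _ f).1 h (fun i => ⟨x i, hx i⟩) hgx

theorem isIntersectionOfMaximal_of_isPrincipal {J : MVIdeal (FreeDMV n)} (hJ : J.IsPrincipal) :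
    J.IsIntersectionOfMaximal := by
  obtain ⟨g, rfl⟩ := hJ
  obtain ⟨g, rfl⟩ : ∃ t, mk t = g := Quotient.exists_rep g
  obtain ⟨F, hFmax, hF⟩ := PLRestrict.exists_maximal_family (lift (PLRestrict.coord (zeros g))) rfl
    (lift_add _) (lift_compl _)
  refine ⟨F, hFmax, Set.ext fun f => ?_⟩
  rw [Set.mem_iInter₂]
  exact (mem_span_iff_lift_eq_zero g f).trans (hF f)

theorem exists_iso_of_isPrincipal {J : MVIdeal (FreeDMV n)} (hJ : J.IsPrincipal) :
    ∃ P : Set (Fin n → unitInterval), IsRationalPolyhedron P ∧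
      Nonempty (DMVIso J.Quot (PLRestrict P)) := by
  obtain ⟨g, rfl⟩ := hJ
  obtain ⟨g, rfl⟩ : ∃ t, mk t = g := Quotient.exists_rep g
  exact ⟨zeros g, g.isRationalPolyhedron_zeros, MVIdeal.nonempty_iso_quot _ _
    (PLRestrict.lift_coord_surjective _) (lift_add _) (lift_compl _) (lift_delta _)
    (mem_span_iff_lift_eq_zero g)⟩

end FreeDMV

/-- Composition of isomorphisms of DMV-algebras. -/
def DMVIso.trans {A B C : Type*} [DMVAlgebra A] [DMVAlgebra B] [DMVAlgebra C] (e : DMVIso A B)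
    (f : DMVIso B C) : DMVIso A C where
  toAddEquiv := e.toAddEquiv.trans f.toAddEquiv
  map_compl x := (congrArg f.toFun (e.map_compl x)).trans (f.map_compl _)
  map_delta k x := (congrArg f.toFun (e.map_delta k x)).trans (f.map_delta k _)

/-- Evaluations at the points of `P` already give maximal ideals with intersection zero, so the
intersection of all maximal ideals is zero. For empty `P` the algebra is trivial and the family
empty. -/
theorem isSemisimpleMV_of_iso {D : Type*} [DMVAlgebra D] {n : ℕ} {P : Set (Fin n → unitInterval)}
    (e : DMVIso D (PLRestrict P)) : IsSemisimpleMV D := by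
  obtain ⟨F, hFmax, hF⟩ := PLRestrict.exists_maximal_family e.toFun (map_zero e.toAddEquiv)
    (map_add e.toAddEquiv) e.map_compl
  refine Set.Subset.antisymm (fun x hx => ?_) ?_
  · rw [Set.mem_iInter₂] at hx
    have h0 : e.toFun x = 0 := (hF x).2 fun M hM => hx M (hFmax M hM)
    exact (map_eq_zero_iff e.toAddEquiv e.toAddEquiv.injective).1 h0
  · rw [Set.singleton_subset_iff, Set.mem_iInter₂]
    exact fun M _ => M.zero_mem

theorem mainTheorem5 :
    (∀ (n : ℕ) (J : MVIdeal (FreeDMV n)), J.IsPrincipal → J.IsIntersectionOfMaximal) ∧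
    (∀ (n : ℕ) (J : MVIdeal (FreeDMV n)), J.IsPrincipal →
      ∃ P : Set (Fin n → unitInterval), IsRationalPolyhedron P ∧
        Nonempty (DMVIso J.Quot (PLRestrict P))) ∧
    (∀ (D : Type*) [DMVAlgebra D], IsFinitelyPresentedDMV D →
      IsSemisimpleMV D ∧
      ∃ (n : ℕ) (P : Set (Fin n → unitInterval)), IsRationalPolyhedron P ∧
        Nonempty (DMVIso D (PLRestrict P))) := by
  refine ⟨fun n J => FreeDMV.isIntersectionOfMaximal_of_isPrincipal,
    fun n J => FreeDMV.exists_iso_of_isPrincipal, ?_⟩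
  rintro D _ ⟨n, J, hJ, ⟨e⟩⟩
  obtain ⟨P, hP, ⟨f⟩⟩ := FreeDMV.exists_iso_of_isPrincipal hJ.isPrincipal
  exact ⟨isSemisimpleMV_of_iso (e.trans f), n, P, hP, ⟨e.trans f⟩⟩
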